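/- Work in Zermelo--Fraenkel set theory $\mathrm{ZF}$, without any form of the Axiom of Choice. A set is \emph{Dedekind-finite} if every injective map from it to itself is surjective. A set $X$ is called \emph{CF} if $X$ is infinite (not in bijection with any natural number) and the set $\mathrm{Fin}(X)$ of all finite subsets of $X$ is Dedekind-finite. Let $\ell^2(X)$ be the Hilbert space of all functions $\eta\colon X\to\mathbb{C}$ with $\sum_{x\in X}|\eta(x)|^2<\infty$ (the supremum of the sums over finite subsets of $X$), with inner product $\langle\eta,\zeta\rangle=\sum_{x\in X}\eta(x)\overline{\zeta(x)}$, and let $\mathcal{B}(\ell^2(X))$ be the $*$-algebra of bounded linear operators on it. \textbf{Corollary.} It is a theorem of $\mathrm{ZF}$ (equivalently, it holds in every model of $\mathrm{ZF}$) that if $X$ is a CF set, then $\mathcal{B}(\ell^2(X))$ is stably finite: for every natural number $n$ there is no $v\in M_n(\mathcal{B}(\ell^2(X)))$ with $v^*v=1$ and $vv^*\neq v^*v$. In other words, every isometry in $\mathcal{B}(\ell^2(X))$, and in each matrix algebra over it, is unitary. -/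

import Mathlib

/-!  The result is a theorem of ZF (no form of Choice), about sets that do not exist under the axiom
of choice.  It is therefore stated as: it holds in every model of ZF.  A model is a type `M`
with a binary relation satisfying the axioms of ZF; "set" means element of `M`, and
natural numbers, functions, sequences, finiteness, real and complex numbers, `ℓ²(X)` and
bounded operators are those of the model. -/

universe u v w

/-- The symbols of the language of set theory: one binary relation. -/
inductive SetSymbol : ℕ → Type
  | mem : SetSymbol 2

/-- The first-order language of set theory. -/
def setLang : FirstOrder.Language.{0, 0} := ⟨fun _ => Empty, SetSymbol⟩

/-- The membership relation of a structure for the language of set theory. -/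
def SetMem {M : Type u} [setLang.Structure M] (x y : M) : Prop :=
  FirstOrder.Language.Structure.RelMap (L := setLang) SetSymbol.mem ![x, y]

infix:50 " ∈ₛ " => SetMem

/-- `M` is a model of Zermelo-Fraenkel set theory ZF (without Choice).  The two schemes range over
the classes that are first-order definable in `M` with parameters from `M`. -/
class ZFModel (M : Type u) [setLang.Structure M] : Prop where
  extensionality : ∀ a b : M, (∀ z, z ∈ₛ a ↔ z ∈ₛ b) → a = b
  foundation : ∀ a : M, (∃ x, x ∈ₛ a) → ∃ x, x ∈ₛ a ∧ ∀ y, y ∈ₛ x → ¬ y ∈ₛ a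
  pairing : ∀ a b : M, ∃ c : M, ∀ z, z ∈ₛ c ↔ z = a ∨ z = b
  union : ∀ a : M, ∃ c : M, ∀ z, z ∈ₛ c ↔ ∃ y, y ∈ₛ a ∧ z ∈ₛ y
  powerset : ∀ a : M, ∃ c : M, ∀ z, z ∈ₛ c ↔ ∀ y, y ∈ₛ z → y ∈ₛ a
  infinity : ∃ c : M, (∃ e, e ∈ₛ c ∧ ∀ z, ¬ z ∈ₛ e) ∧
    ∀ n, n ∈ₛ c → ∃ s, s ∈ₛ c ∧ ∀ z, z ∈ₛ s ↔ z ∈ₛ n ∨ z = n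
  separation : ∀ D : Set M, Set.Definable₁ Set.univ setLang D →
    ∀ a : M, ∃ c : M, ∀ z, z ∈ₛ c ↔ z ∈ₛ a ∧ z ∈ D
  replacement : ∀ G : Set (M × M), Set.Definable₂ Set.univ setLang G →
    ∀ a : M, (∀ x, x ∈ₛ a → ∃! y, (x, y) ∈ G) →
      ∃ c : M, ∀ y, y ∈ₛ c ↔ ∃ x, x ∈ₛ a ∧ (x, y) ∈ G

namespace ZFModel

section Basic

variable {M : Type u} [setLang.Structure M] [ZFModel M]

theorem exists_empty : ∃ e : M, ∀ z, ¬ z ∈ₛ e := by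
  obtain ⟨c, ⟨e, -, he⟩, -⟩ := infinity (M := M)
  exact ⟨e, he⟩

theorem exists_succ (n : M) : ∃ s : M, ∀ z, z ∈ₛ s ↔ z ∈ₛ n ∨ z = n := by
  obtain ⟨b, hb⟩ := pairing n n
  obtain ⟨c, hc⟩ := pairing n b
  obtain ⟨s, hs⟩ := union c
  refine ⟨s, fun z => ?_⟩
  rw [hs]
  constructor
  · rintro ⟨y, hy, hz⟩
    rcases (hc y).1 hy with rfl | rfl
    · exact Or.inl hz
    · rcases (hb z).1 hz with h | h <;> exact Or.inr h
  · rintro (h | h)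
    · exact ⟨n, (hc n).2 (Or.inl rfl), h⟩
    · exact ⟨b, (hc b).2 (Or.inr rfl), (hb z).2 (Or.inl h)⟩

/-- The unordered pair `{x, y}`. -/
noncomputable def upair (x y : M) : M := (pairing x y).choose

theorem mem_upair {x y z : M} : z ∈ₛ upair x y ↔ z = x ∨ z = y :=
  (pairing x y).choose_spec z

/-- The ordered pair `{{x}, {x, y}}`. -/
noncomputable def pair (x y : M) : M := upair (upair x x) (upair x y)

/-- The empty set. -/
noncomputable def empty : M := (exists_empty (M := M)).choose

theorem not_mem_empty (z : M) : ¬ z ∈ₛ (empty : M) := (exists_empty (M := M)).choose_spec z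

/-- The successor `n ∪ {n}`. -/
noncomputable def succ (n : M) : M := (exists_succ n).choose

theorem mem_succ {n z : M} : z ∈ₛ succ n ↔ z ∈ₛ n ∨ z = n := (exists_succ n).choose_spec z

theorem upair_inj {a b c d : M} (h : upair a b = upair c d) :
    (a = c ∧ b = d) ∨ (a = d ∧ b = c) := by
  have ha : a = c ∨ a = d := mem_upair.1 (h ▸ mem_upair.2 (Or.inl rfl))
  have hb : b = c ∨ b = d := mem_upair.1 (h ▸ mem_upair.2 (Or.inr rfl))
  have hc : c = a ∨ c = b := mem_upair.1 (h.symm ▸ mem_upair.2 (Or.inl rfl))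
  have hd : d = a ∨ d = b := mem_upair.1 (h.symm ▸ mem_upair.2 (Or.inr rfl))
  grind

theorem pair_inj {a b c d : M} (h : pair a b = pair c d) : a = c ∧ b = d := by
  rcases upair_inj h with ⟨h1, h2⟩ | ⟨h1, h2⟩
  · have h3 := upair_inj h1
    have h4 := upair_inj h2
    grind
  · have h3 := upair_inj h1
    have h4 := upair_inj h2
    grind

end Basic

/-- `El a` is the type of elements of the set `a`. -/
abbrev El {M : Type u} [setLang.Structure M] (a : M) : Type u := {x : M // x ∈ₛ a}

/-- `α` is a type of objects of the model `M`: every element is given by an element of `M`. -/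
class Coded (M : Type u) (α : Type v) where
  code : α → M
  code_injective : Function.Injective code

section Coding

variable (M : Type u) [setLang.Structure M] [ZFModel M]

instance codedSubtype (p : M → Prop) : Coded M {x : M // p x} :=
  ⟨Subtype.val, Subtype.val_injective⟩

noncomputable instance codedProd (α : Type v) (β : Type w) [Coded M α] [Coded M β] :
    Coded M (α × β) where
  code p := pair (Coded.code p.1) (Coded.code p.2)
  code_injective _ _ h :=
    Prod.ext (Coded.code_injective (pair_inj h).1) (Coded.code_injective (pair_inj h).2)

variable {α : Type v} {β : Type w} [Coded M α] [Coded M β]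

/-- The function `f` belongs to the model: its graph is an element of `M`. -/
def Internal (f : α → β) : Prop :=
  ∃ g : M, ∀ p, p ∈ₛ g ↔ ∃ x, p = pair (Coded.code x) (Coded.code (f x))

variable {M}

/-- The graph of a function that belongs to the model. -/
noncomputable def graph {f : α → β} (hf : Internal M f) : M := hf.choose

theorem graph_inj {f g : α → β} (hf : Internal M f) (hg : Internal M g)
    (h : graph hf = graph hg) : f = g := by
  funext x
  have h1 : pair (Coded.code x) (Coded.code (f x)) ∈ₛ graph hf := (hf.choose_spec _).2 ⟨x, rfl⟩
  rw [h] at h1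
  obtain ⟨y, hy⟩ := (hg.choose_spec _).1 h1
  obtain rfl : x = y := Coded.code_injective (pair_inj hy).1
  exact Coded.code_injective (pair_inj hy).2

end Coding

section Numbers

variable {M : Type u} [setLang.Structure M] [ZFModel M]

/-- `n` is a natural number of the model: it belongs to every inductive set. -/
def IsNat (n : M) : Prop :=
  ∀ c : M, empty ∈ₛ c → (∀ k, k ∈ₛ c → succ k ∈ₛ c) → n ∈ₛ c

variable (M) in
/-- The natural numbers of the model (von Neumann: `n = {0, …, n - 1}`). -/
abbrev Omega : Type u := {n : M // IsNat n}

namespace Omega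

/-- The natural number `0`. -/
noncomputable def zero : Omega M := ⟨empty, fun _ h _ => h⟩

/-- The natural number `n + 1`. -/
noncomputable def succ (n : Omega M) : Omega M :=
  ⟨ZFModel.succ n.1, fun c h0 h1 => h1 _ (n.2 c h0 h1)⟩

end Omega

/-- The set `a` is finite in the model: it is in bijection with a natural number. -/
def IsFin (a : M) : Prop :=
  ∃ (n : Omega M) (e : El n.1 → El a), Internal M e ∧ Function.Bijective e

/-- `Fin(X)`: the finite subsets of `X`. -/
abbrev FinSub (X : M) : Type u := {F : M // (∀ x, x ∈ₛ F → x ∈ₛ X) ∧ IsFin F}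

/-- The inclusion of a finite subset of `X` into `X`. -/
def FinSub.incl {X : M} (F : FinSub X) (x : El F.1) : El X := ⟨x.1, F.2.1 x.1 x.2⟩

variable (M) in
/-- A set of the model, given as a type of objects of the model, is Dedekind-finite: every injective
function of the model from it to itself is surjective. -/
def DedekindFinite (α : Type v) [Coded M α] : Prop :=
  ∀ f : α → α, Internal M f → Function.Injective f → Function.Surjective f

/-- `X` is Cohen-finite: `Fin(X)` is Dedekind-finite. -/
def CohenFinite (X : M) : Prop := DedekindFinite M (FinSub X)

/-- `X` is CF: infinite and Cohen-finite. -/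
def CF (X : M) : Prop := ¬ IsFin X ∧ CohenFinite X

/-- `c` is the sum of the values of `g` over the finite set `F`: for an enumeration `e` of `F` by
a natural number `n`, the sequence `s` of partial sums has final value `c`. -/
def HasFinSum {β : Type v} [Coded M β] [Zero β] [Add β] (F : M) (g : El F → β) (c : β) : Prop :=
  ∃ (n : Omega M) (e : El n.1 → El F) (s : Omega M → β),
    Internal M e ∧ Function.Bijective e ∧ Internal M s ∧ s Omega.zero = 0 ∧
    (∀ (k : Omega M) (hk : k.1 ∈ₛ n.1), s k.succ = s k + g (e ⟨k.1, hk⟩)) ∧ s n = c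

variable (M) in
/-- The real numbers of the model: a set `carrier` with operations and an order that belong to the
model and make it an ordered field in which every nonempty bounded subset belonging to the model
has a least upper bound.  ZF proves that it exists and is unique up to unique isomorphism. -/
structure Reals where
  carrier : M
  [field : Field (El carrier)]
  [order : LinearOrder (El carrier)]
  [ordered : IsStrictOrderedRing (El carrier)]
  add_internal : Internal M (fun p : El carrier × El carrier => p.1 + p.2)
  mul_internal : Internal M (fun p : El carrier × El carrier => p.1 * p.2)
  le_internal : ∃ r : M, ∀ p, p ∈ₛ r ↔ ∃ x y : El carrier, x ≤ y ∧ p = pair x.1 y.1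
  complete : ∀ S : M, (∀ x, x ∈ₛ S → x ∈ₛ carrier) → (∃ x, x ∈ₛ S) →
    BddAbove {x : El carrier | x.1 ∈ₛ S} → ∃ b, IsLUB {x : El carrier | x.1 ∈ₛ S} b

attribute [instance] Reals.field Reals.order Reals.ordered

/-- The complex numbers of the model: `R[i]` with `i ^ 2 = -1`. -/
abbrev Cplx (R : Reals M) : Type u := QuadraticAlgebra (El R.carrier) (-1) 0

/-- A complex number is coded by the pair of its real and imaginary parts. -/
noncomputable instance codedCplx (R : Reals M) : Coded M (Cplx R) where
  code z := pair z.re.1 z.im.1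
  code_injective _ _ h :=
    QuadraticAlgebra.ext (Subtype.ext (pair_inj h).1) (Subtype.ext (pair_inj h).2)

/-- `|z| ^ 2`. -/
def absSq {R : Reals M} (z : Cplx R) : El R.carrier := z.re ^ 2 + z.im ^ 2

end Numbers

section Operators

variable {M : Type u} [setLang.Structure M] [ZFModel M] {R : Reals M} {X : M}

/-- The sums of `|f x| ^ 2` over the finite subsets of `X`. -/
def squareSums (f : El X → Cplx R) : Set (El R.carrier) :=
  {c | ∃ F : FinSub X, HasFinSum F.1 (fun x => absSq (f (F.incl x))) c}

variable (R X) in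
/-- `ℓ²(X)`: the square-summable complex-valued functions on `X`. -/
structure L2 where
  toFun : El X → Cplx R
  internal : Internal M toFun
  summable : BddAbove (squareSums toFun)

instance : CoeFun (L2 R X) (fun _ => El X → Cplx R) := ⟨L2.toFun⟩

noncomputable instance codedL2 : Coded M (L2 R X) where
  code f := graph f.internal
  code_injective f g h := by
    cases f; cases g
    congr
    exact graph_inj _ _ h

/-- `c = ‖f‖ ^ 2`. -/
def L2.HasNormSq (f : L2 R X) (c : El R.carrier) : Prop := IsLUB (squareSums f) c

/-- `c = ⟨f, g⟩`: the sums of `f x * conj (g x)` over the finite subsets of `X` converge to `c`. -/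
def L2.HasInner (f g : L2 R X) (c : Cplx R) : Prop :=
  ∀ ε : El R.carrier, 0 < ε → ∃ F₀ : FinSub X, ∀ F : FinSub X, (∀ x, x ∈ₛ F₀.1 → x ∈ₛ F.1) →
    ∀ d, HasFinSum F.1 (fun x => f (F.incl x) * star (g (F.incl x))) d → absSq (d - c) < ε

variable (R X) in
/-- `𝓑(ℓ²(X))`: the bounded linear operators on `ℓ²(X)`. -/
structure BddOp where
  toFun : L2 R X → L2 R X
  internal : Internal M toFun
  linear : ∀ (a : Cplx R) (f g h : L2 R X), (∀ x, h x = a * f x + g x) →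
    ∀ x, toFun h x = a * toFun f x + toFun g x
  bounded : ∃ K : El R.carrier, ∀ (f : L2 R X) (b c : El R.carrier),
    f.HasNormSq b → (toFun f).HasNormSq c → c ≤ K * b

instance : CoeFun (BddOp R X) (fun _ => L2 R X → L2 R X) := ⟨BddOp.toFun⟩

noncomputable instance codedBddOp : Coded M (BddOp R X) where
  code T := graph T.internal
  code_injective T S h := by
    cases T; cases S
    congr
    exact graph_inj _ _ h

/-- `S = T*`: `⟨T f, g⟩ = ⟨f, S g⟩` for all `f` and `g`. -/
def BddOp.IsAdjoint (T S : BddOp R X) : Prop :=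
  ∀ (f g : L2 R X) (c : Cplx R), (T f).HasInner g c ↔ f.HasInner (S g) c

variable (R X) in
/-- `M_n(𝓑(ℓ²(X)))`, for a natural number `n` of the model. -/
structure OpMatrix (n : Omega M) where
  entry : El n.1 × El n.1 → BddOp R X
  internal : Internal M entry

/-- `W = V*`: the entry `(i, j)` of `W` is the adjoint of the entry `(j, i)` of `V`. -/
def OpMatrix.IsStar {n : Omega M} (V W : OpMatrix R X n) : Prop :=
  ∀ i j, (V.entry (j, i)).IsAdjoint (W.entry (i, j))

open Classical in
/-- `V W = 1`: the operator `∑ k, V i k ∘ W k j`, evaluated at any vector and coordinate,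
is the identity for `i = j` and zero for `i ≠ j`. -/
def OpMatrix.MulEqOne {n : Omega M} (V W : OpMatrix R X n) : Prop :=
  ∀ (i j : El n.1) (f : L2 R X) (x : El X),
    HasFinSum n.1 (fun k => V.entry (i, k) (W.entry (k, j) f) x) (if i = j then f x else 0)

variable (R X) in
/-- `𝓑(ℓ²(X))` is stably finite: for every `n` there is no `V` in `M_n(𝓑(ℓ²(X)))` such that
`V* V = 1` and `V V* ≠ V* V`. -/
def StablyFinite : Prop :=
  ∀ n : Omega M, ¬ ∃ V W : OpMatrix R X n, V.IsStar W ∧ W.MulEqOne V ∧ ¬ V.MulEqOne W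

end Operators

end ZFModel

/-! The engine is a fixed point principle. If `ψ` is a definable increasing map on the finite
subsets of a Cohen-finite `X`, then above every `A₀` there is a finite `A` with `ψ A = A`. Otherwise
the iterates of `ψ` at `A₀` would grow strictly, and the map equal to `ψ` on them and to the
identity elsewhere would be injective on `Fin(X)` and miss `A₀` (`CohenFinite.exists_fixed`).

It is used twice. First, every vector of `ℓ²(X)` has finite support (`CohenFinite.exists_support`):
let `ψ` adjoin to `A` the points where `|f|²` is nonzero and maximal among its values outside `A`.
Only finitely many points carry a value above a given positive bound, so `ψ A` is finite, and a
fixed point contains the whole support. Secondly, given a matrix `V` of operators and its adjoint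
`W`, let `ψ` adjoin the supports of the images of the basis vectors indexed by `A` under all
entries. A fixed point spans a finite-dimensional subspace invariant under both matrices
(`OpMatrix.exists_invariant`), and it can be chosen to contain a given vector and a given
coordinate. On this subspace `V* V = 1` forces `V V* = 1` by linear algebra (`matMul_star_eq_one`),
and the vector was arbitrary.

The remaining work keeps everything inside the model. Separation, Replacement, induction and
Dedekind-finiteness apply only to definable or internal data, so each construction must be shown
definable. `DFun` expresses this, and `fun_prop` proves it compositionally. Lean's `choose` does no
harm, because every object chosen is determined uniquely by a definable condition and
`DFun.of_graph` then applies. -/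

namespace ZFModel

open FirstOrder Function

/-! ### Closure properties of first-order definability with parameters -/

section Formulas

variable {M : Type u} [setLang.Structure M]

variable (M) in
/-- A property of assignments `ℕ → M` is first-order definable with parameters. -/
def RawDef (P : (ℕ → M) → Prop) : Prop := Set.univ.Definable setLang {v | P v}

theorem RawDef.congr {P Q : (ℕ → M) → Prop} (h : RawDef M P) (hPQ : ∀ v, Q v ↔ P v) :
    RawDef M Q := by
  obtain rfl : Q = P := funext fun v => propext (hPQ v)
  exact h

theorem RawDef.and {P Q : (ℕ → M) → Prop} (hP : RawDef M P) (hQ : RawDef M Q) :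
    RawDef M fun v => P v ∧ Q v := Set.Definable.inter hP hQ

theorem RawDef.or {P Q : (ℕ → M) → Prop} (hP : RawDef M P) (hQ : RawDef M Q) :
    RawDef M fun v => P v ∨ Q v := Set.Definable.union hP hQ

theorem RawDef.not {P : (ℕ → M) → Prop} (hP : RawDef M P) : RawDef M fun v => ¬ P v :=
  Set.Definable.compl hP

theorem RawDef.iff {P Q : (ℕ → M) → Prop} (hP : RawDef M P) (hQ : RawDef M Q) :
    RawDef M fun v => P v ↔ Q v :=
  ((hP.and hQ).or (hP.not.and hQ.not)).congr fun v => by tauto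

theorem RawDef.ex {P : (ℕ → M) → Prop} (hP : RawDef M P) (k : ℕ) :
    RawDef M fun v => ∃ m, P (update v k m) := by
  obtain ⟨φ, hφ⟩ := hP
  -- Relabelling turns the free variable `k` into the bound variable and leaves the others free.
  refine ⟨Language.BoundedFormula.ex (n := 0) (Language.BoundedFormula.relabel (n := 1) (k := 0) (φ := φ)
    (fun i : ℕ => if i = k then Sum.inr (0 : Fin 1) else Sum.inl i)), ?_⟩
  ext v
  have h1 : ∀ w : ℕ → M, P w ↔ φ.Realize w := fun w => Set.ext_iff.1 hφ w
  simp only [Set.mem_ofPred_eq, Language.Formula.Realize, Language.BoundedFormula.realize_ex]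
  refine exists_congr fun m => ?_
  rw [h1, Language.BoundedFormula.realize_relabel, Language.Formula.Realize]
  have h2 : update v k m = (Sum.elim v ((Fin.snoc default m : Fin 1 → M) ∘ Fin.castAdd 0) ∘
      fun i : ℕ => if i = k then Sum.inr (0 : Fin 1) else Sum.inl i) := by
    funext i
    by_cases h : i = k
    · subst h; simp [Fin.snoc]
    · simp [h]
  rw [← h2]
  exact iff_of_eq (congrArg _ (Subsingleton.elim _ _))

theorem RawDef.all {P : (ℕ → M) → Prop} (hP : RawDef M P) (k : ℕ) :
    RawDef M fun v => ∀ m, P (update v k m) :=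
  (hP.not.ex k).not.congr fun v => by push Not; rfl

theorem rawDef_mem (i j : ℕ) : RawDef M fun v => v i ∈ₛ v j := by
  let r : (setLang[[(Set.univ : Set M)]]).Relations 2 := Sum.inl SetSymbol.mem
  refine ⟨r.formula₂ (Language.Term.var i) (Language.Term.var j), ?_⟩
  ext v
  simp only [Set.mem_ofPred_eq, Language.Formula.realize_rel₂, Language.Term.realize_var]
  rfl

theorem rawDef_eq (i j : ℕ) : RawDef M fun v => v i = v j := by
  refine ⟨Language.Term.equal (Language.Term.var i) (Language.Term.var j), ?_⟩
  ext v
  simp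

theorem rawDef_eq_const (i : ℕ) (c : M) : RawDef M fun v => v i = c := by
  refine ⟨Language.Term.equal (Language.Term.var i)
    (Language.Constants.term ((setLang.con (⟨c, trivial⟩ : (Set.univ : Set M))))), ?_⟩
  ext v
  simp

theorem rawDef_mem_definable {D : Set M} (hD : Set.Definable₁ Set.univ setLang D) (i : ℕ) :
    RawDef M fun v => v i ∈ D :=
  Set.Definable.preimage_comp (fun _ : Fin 1 => i) hD

/-- All variables receive the value `m`. In the applications every variable other than `0` is
quantified, so only variable `0` really carries `m`. -/
theorem RawDef.definable₁ {P : (ℕ → M) → Prop} (hP : RawDef M P) :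
    Set.Definable₁ Set.univ setLang {m : M | P fun _ => m} :=
  Set.Definable.preimage_comp (fun _ : ℕ => (0 : Fin 1)) hP

theorem RawDef.definable₂ {P : (ℕ → M) → Prop} (hP : RawDef M P) :
    Set.Definable₂ Set.univ setLang {m : M × M | P fun i => if i = 0 then m.1 else m.2} := by
  have := Set.Definable.preimage_comp (fun i : ℕ => if i = 0 then (0 : Fin 2) else 1) hP
  refine Eq.mp ?_ this
  unfold Set.Definable₂
  congr 1
  ext v
  simp only [Set.mem_preimage, Set.mem_ofPred_eq]
  refine iff_of_eq (congrArg P ?_)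
  funext i
  simp only [comp]
  split_ifs <;> rfl

variable [ZFModel M]

theorem eq_iff_mem (a b : M) : a = b ↔ ∀ z, z ∈ₛ a ↔ z ∈ₛ b :=
  ⟨fun h _ => h ▸ Iff.rfl, extensionality a b⟩

theorem eq_upair_iff (a b c : M) : a = upair b c ↔ ∀ z, z ∈ₛ a ↔ z = b ∨ z = c := by
  simp only [eq_iff_mem a, mem_upair]

theorem rawDef_eq_upair (i j k : ℕ) : RawDef M fun v => v i = upair (v j) (v k) := by
  -- An index larger than `i`, `j` and `k` is a fresh variable.
  refine RawDef.congr (RawDef.all (k := i + j + k + 1)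
    ((rawDef_mem (i + j + k + 1) i).iff
      ((rawDef_eq (i + j + k + 1) j).or (rawDef_eq (i + j + k + 1) k)))) fun v => ?_
  have h1 : i ≠ i + j + k + 1 := by omega
  have h2 : j ≠ i + j + k + 1 := by omega
  have h3 : k ≠ i + j + k + 1 := by omega
  simp [eq_upair_iff, update_of_ne h1, update_of_ne h2, update_of_ne h3]

theorem rawDef_eq_pair (i j k : ℕ) : RawDef M fun v => v i = pair (v j) (v k) := by
  refine RawDef.congr (RawDef.ex (k := i + j + k + 1) (RawDef.ex (k := i + j + k + 2)
    ((rawDef_eq_upair (i + j + k + 1) j j).and ((rawDef_eq_upair (i + j + k + 2) j k).and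
      (rawDef_eq_upair i (i + j + k + 1) (i + j + k + 2)))))) fun v => ?_
  have h1 : i ≠ i + j + k + 1 := by omega
  have h2 : j ≠ i + j + k + 1 := by omega
  have h3 : k ≠ i + j + k + 1 := by omega
  have h4 : i ≠ i + j + k + 2 := by omega
  have h5 : j ≠ i + j + k + 2 := by omega
  have h6 : k ≠ i + j + k + 2 := by omega
  have h7 : i + j + k + 1 ≠ i + j + k + 2 := by omega
  simp [pair, update_of_ne h1, update_of_ne h2, update_of_ne h3,
    update_of_ne h4, update_of_ne h5, update_of_ne h6]

end Formulas

end ZFModel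

namespace ZFModel

open Function

theorem code_inj {M : Type u} {α : Type v} [Coded M α] {a b : α} :
    (Coded.code a : M) = Coded.code b ↔ a = b := Coded.code_injective.eq_iff

/-! ### Definable class functions and predicates on coded types -/

section DefinableFunctions

variable (M : Type u) [setLang.Structure M]

/-- The objects of the type `α` form a definable class of the model. -/
class DType (α : Type v) [Coded M α] : Prop where
  definable : Set.Definable₁ Set.univ setLang {m : M | ∃ a : α, m = Coded.code a}

/-- The objects of the type `α` form a set of the model. -/
class SType (α : Type v) [Coded M α] : Prop where
  exists_set : ∃ s : M, ∀ m, m ∈ₛ s ↔ ∃ a : α, m = Coded.code a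

instance codedSelf : Coded M M := ⟨id, injective_id⟩

instance dTypeSelf : DType M M := by
  refine ⟨?_⟩
  convert (rawDef_eq (M := M) 0 0).definable₁ using 1
  ext m
  simp [Coded.code]

instance (priority := 50) dTypeOfSType (α : Type v) [Coded M α] [SType M α] : DType M α := by
  obtain ⟨s, hs⟩ := SType.exists_set (M := M) (α := α)
  refine ⟨?_⟩
  convert ((rawDef_eq_const 1 s).and (rawDef_mem (M := M) 0 1)).ex 1 |>.definable₁ using 1
  ext m
  simp [hs]

instance sTypeEl (a : M) : SType M (El a) :=
  ⟨a, fun m => ⟨fun h => ⟨⟨m, h⟩, rfl⟩, by rintro ⟨x, rfl⟩; exact x.2⟩⟩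

variable [ZFModel M]

open Classical in
/-- A truth value is coded by `∅` or `{∅}`. -/
noncomputable instance codedProp : Coded M Prop where
  code p := if p then upair empty empty else empty
  code_injective p q h := by
    have h1 : (empty : M) ≠ upair empty empty := fun h => (by
      have := mem_upair.2 (Or.inl rfl : (empty : M) = empty ∨ (empty : M) = empty)
      exact not_mem_empty (M := M) empty (by rwa [← h] at this))
    by_cases hp : p <;> by_cases hq : q <;> simp_all

variable {α : Type*} {β : Type*} {γ : Type*} [Coded M α] [Coded M β] [Coded M γ]

theorem code_pair (a : α) (b : β) :
    (Coded.code (a, b) : M) = pair (Coded.code a) (Coded.code b) := rfl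

/-- The objects with the property `P` form a definable class of the model. -/
def DPred (P : α → Prop) : Prop :=
  Set.Definable₁ Set.univ setLang {m : M | ∃ a : α, m = Coded.code a ∧ P a}

/-- The function `f` is a definable class function of the model. -/
@[fun_prop]
def DFun (f : α → β) : Prop :=
  Set.Definable₁ Set.univ setLang
    {m : M | ∃ a : α, m = pair (Coded.code a) (Coded.code (f a))}

variable {M}

theorem pair_eq_iff {a b c d : M} : pair a b = pair c d ↔ a = c ∧ b = d :=
  ⟨pair_inj, by rintro ⟨rfl, rfl⟩; rfl⟩

instance dTypeProd [DType M α] [DType M β] : DType M (α × β) := by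
  refine ⟨?_⟩
  convert ((((rawDef_mem_definable (DType.definable (M := M) (α := α)) 1).and
    (rawDef_mem_definable (DType.definable (M := M) (α := β)) 2)).and
    (rawDef_eq_pair (M := M) 0 1 2)).ex 2).ex 1 |>.definable₁ using 1
  ext m
  simp [code_pair]

/-- Treating predicates as functions to `Prop` lets `fun_prop` handle formulas and functions alike.
The class of `P` is the fibre of its graph over the code of `True`. -/
theorem DFun.dPred [DType M α] {P : α → Prop} (h : DFun M P) : DPred M P := by
  unfold DPred
  convert (((rawDef_mem_definable h 1).and
    ((rawDef_eq_pair (M := M) 1 0 2).and (rawDef_eq_const 2 (Coded.code True : M)))).ex 2).ex 1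
    |>.definable₁ using 1
  ext m
  simp only [Set.mem_ofPred_eq]
  constructor
  · rintro ⟨a, rfl, ha⟩
    refine ⟨pair (Coded.code a) (Coded.code True), Coded.code True, ?_⟩
    simp [update, pair_eq_iff, code_inj, ha]
  · rintro ⟨x, y, h⟩
    simp [update] at h
    obtain ⟨⟨a, rfl⟩, h, rfl⟩ := h
    rw [pair_eq_iff, code_inj] at h
    exact ⟨a, h.1.symm, by simp [h.2]⟩

theorem DPred.dFun [DType M α] {P : α → Prop} (h : DPred M P) : DFun M P := by
  unfold DFun
  have hA := DType.definable (M := M) (α := α)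
  convert ((((rawDef_mem_definable h 1).and (rawDef_eq_const 2 (Coded.code True : M))).or
    (((rawDef_mem_definable hA 1).and (rawDef_mem_definable h 1).not).and
      (rawDef_eq_const 2 (Coded.code False : M)))).and
    (rawDef_eq_pair (M := M) 0 1 2)).ex 2 |>.ex 1
    |>.definable₁ using 1
  ext m
  simp only [Set.mem_ofPred_eq]
  constructor
  · rintro ⟨a, rfl⟩
    refine ⟨Coded.code a, Coded.code (P a), ?_⟩
    by_cases ha : P a <;> simp [update, ha, code_inj]
  · rintro ⟨x, y, h⟩
    simp [update] at h
    obtain ⟨⟨⟨a, rfl, ha⟩, rfl⟩ | ⟨⟨⟨a, rfl⟩, ha⟩, rfl⟩, rfl⟩ := h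
    · exact ⟨a, by simp [ha]⟩
    · exact ⟨a, by simp [show ¬ P a from fun h => ha a rfl h]⟩

theorem dFun_iff_dPred [DType M α] {P : α → Prop} : DFun M P ↔ DPred M P :=
  ⟨DFun.dPred, DPred.dFun⟩

@[fun_prop]
theorem dFun_id [DType M α] : DFun M (fun x : α => x) := by
  unfold DFun
  convert ((rawDef_mem_definable (DType.definable (M := M) (α := α)) 1).and
    (rawDef_eq_pair (M := M) 0 1 1)).ex 1 |>.definable₁ using 1
  ext m
  simp

@[fun_prop]
theorem dFun_const [DType M α] (b : β) : DFun M (fun _ : α => b) := by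
  unfold DFun
  convert (((rawDef_mem_definable (DType.definable (M := M) (α := α)) 1).and
    (rawDef_eq_const 2 (Coded.code b))).and
    (rawDef_eq_pair (M := M) 0 1 2)).ex 2 |>.ex 1 |>.definable₁ using 1
  ext m
  simp [update]

@[fun_prop]
theorem DFun.comp {f : β → γ} {g : α → β} (hf : DFun M f) (hg : DFun M g) :
    DFun M (fun x => f (g x)) := by
  unfold DFun
  -- Variables 1, 2, 3 stand for `x`, `g x`, `f (g x)`; variables 4 and 5 are the corresponding
  -- elements of the two graphs.
  convert (((((rawDef_mem_definable hg 4).and (rawDef_mem_definable hf 5)).and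
    ((rawDef_eq_pair 4 1 2).and (rawDef_eq_pair 5 2 3))).and
    (rawDef_eq_pair (M := M) 0 1 3)).ex 5).ex 4 |>.ex 3 |>.ex 2 |>.ex 1 |>.definable₁ using 1
  ext m
  simp only [Set.mem_ofPred_eq]
  constructor
  · rintro ⟨a, rfl⟩
    refine ⟨Coded.code a, Coded.code (g a), Coded.code (f (g a)), pair (Coded.code a)
      (Coded.code (g a)), pair (Coded.code (g a)) (Coded.code (f (g a))), ?_⟩
    simp [update, pair_eq_iff, code_inj]
  · rintro ⟨x, y, z, s, t, h⟩
    simp [update] at h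
    obtain ⟨⟨⟨⟨a, rfl⟩, ⟨b, rfl⟩⟩, h1, h2⟩, rfl⟩ := h
    obtain ⟨rfl, rfl⟩ := pair_inj h1
    obtain ⟨h3, rfl⟩ := pair_inj h2
    rw [code_inj] at h3
    exact ⟨a, by rw [h3]⟩

@[fun_prop]
theorem DFun.prodMk {f : α → β} {g : α → γ} (hf : DFun M f) (hg : DFun M g) :
    DFun M (fun x => (f x, g x)) := by
  unfold DFun
  convert (((((rawDef_mem_definable hf 4).and (rawDef_mem_definable hg 5)).and
    ((rawDef_eq_pair 4 1 2).and (rawDef_eq_pair 5 1 3))).and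
    ((rawDef_eq_pair (M := M) 0 1 6).and (rawDef_eq_pair 6 2 3))).ex 6).ex 5 |>.ex 4 |>.ex 3
    |>.ex 2 |>.ex 1 |>.definable₁ using 1
  ext m
  simp only [Set.mem_ofPred_eq]
  constructor
  · rintro ⟨a, rfl⟩
    refine ⟨Coded.code a, Coded.code (f a), Coded.code (g a), pair (Coded.code a)
      (Coded.code (f a)), pair (Coded.code a) (Coded.code (g a)), Coded.code (f a, g a), ?_⟩
    simp [update, pair_eq_iff, code_inj, code_pair]
  · rintro ⟨x, y, z, s, t, r, h⟩
    simp [update] at h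
    obtain ⟨⟨⟨⟨a, rfl⟩, ⟨b, rfl⟩⟩, h1, h2⟩, rfl, rfl⟩ := h
    obtain ⟨rfl, rfl⟩ := pair_inj h1
    obtain ⟨h3, rfl⟩ := pair_inj h2
    rw [code_inj] at h3
    subst h3
    exact ⟨b, rfl⟩

theorem dFun_fst [DType M α] [DType M β] : DFun M (Prod.fst : α × β → α) := by
  unfold DFun
  convert ((((rawDef_mem_definable (DType.definable (M := M) (α := α)) 1).and
    (rawDef_mem_definable (DType.definable (M := M) (α := β)) 2)).and
    ((rawDef_eq_pair (M := M) 0 3 1).and (rawDef_eq_pair (M := M) 3 1 2))).ex 3).ex 2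
      |>.ex 1 |>.definable₁ using 1
  ext m
  simp [code_pair, update]

theorem dFun_snd [DType M α] [DType M β] : DFun M (Prod.snd : α × β → β) := by
  unfold DFun
  convert ((((rawDef_mem_definable (DType.definable (M := M) (α := α)) 1).and
    (rawDef_mem_definable (DType.definable (M := M) (α := β)) 2)).and
    ((rawDef_eq_pair (M := M) 0 3 2).and (rawDef_eq_pair (M := M) 3 1 2))).ex 3).ex 2
      |>.ex 1 |>.definable₁ using 1
  ext m
  simp [code_pair, update]

@[fun_prop]
theorem DFun.fst [DType M β] [DType M γ] {f : α → β × γ} (hf : DFun M f) :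
    DFun M (fun x => (f x).1) := dFun_fst.comp hf

@[fun_prop]
theorem DFun.snd [DType M β] [DType M γ] {f : α → β × γ} (hf : DFun M f) :
    DFun M (fun x => (f x).2) := dFun_snd.comp hf

@[fun_prop]
theorem DFun.and [DType M α] {P Q : α → Prop} (hP : DFun M P) (hQ : DFun M Q) :
    DFun M (fun x => P x ∧ Q x) := by
  rw [dFun_iff_dPred] at *
  unfold DPred
  convert ((rawDef_mem_definable hP 0).and (rawDef_mem_definable hQ 0)).definable₁ using 1
  ext m
  simp only [Set.mem_ofPred_eq]
  constructor
  · rintro ⟨a, rfl, h, h'⟩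
    exact ⟨⟨a, rfl, h⟩, ⟨a, rfl, h'⟩⟩
  · rintro ⟨⟨a, rfl, h⟩, ⟨b, h1, h'⟩⟩
    rw [code_inj] at h1
    subst h1
    exact ⟨a, rfl, h, h'⟩

@[fun_prop]
theorem DFun.not [DType M α] {P : α → Prop} (hP : DFun M P) : DFun M (fun x => ¬ P x) := by
  rw [dFun_iff_dPred] at *
  unfold DPred
  convert ((rawDef_mem_definable (DType.definable (M := M) (α := α)) 0).and
    (rawDef_mem_definable hP 0).not).definable₁ using 1
  ext m
  simp only [Set.mem_ofPred_eq]
  constructor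
  · rintro ⟨a, rfl, h⟩
    refine ⟨⟨a, rfl⟩, fun ⟨b, hb, h'⟩ => h ?_⟩
    rw [code_inj] at hb
    rwa [hb]
  · rintro ⟨⟨a, rfl⟩, h⟩
    exact ⟨a, rfl, fun h' => h ⟨a, rfl, h'⟩⟩

@[fun_prop]
theorem DFun.ex [DType M α] [DType M β] {P : α → β → Prop}
    (hP : DFun M (fun p : α × β => P p.1 p.2)) : DFun M (fun x => ∃ y, P x y) := by
  rw [dFun_iff_dPred] at *
  unfold DPred
  convert (((rawDef_mem_definable hP 2).and (rawDef_eq_pair (M := M) 2 0 1)).ex 2).ex 1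
    |>.definable₁ using 1
  ext m
  simp [code_pair, update, pair_eq_iff]

@[fun_prop]
theorem DFun.or [DType M α] {P Q : α → Prop} (hP : DFun M P) (hQ : DFun M Q) :
    DFun M (fun x => P x ∨ Q x) := by
  have : DFun M (fun x => ¬ (¬ P x ∧ ¬ Q x)) := by fun_prop
  simpa only [not_and_or, not_not] using this

@[fun_prop]
theorem DFun.iff [DType M α] {P Q : α → Prop} (hP : DFun M P) (hQ : DFun M Q) :
    DFun M (fun x => P x ↔ Q x) := by
  have : DFun M (fun x => (P x ∧ Q x) ∨ (¬ P x ∧ ¬ Q x)) := by fun_prop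
  simpa only [← iff_iff_and_or_not_and_not] using this

@[fun_prop]
theorem DFun.imp [DType M α] {P Q : α → Prop} (hP : DFun M P) (hQ : DFun M Q) :
    DFun M (fun x => P x → Q x) := by
  have : DFun M (fun x => ¬ P x ∨ Q x) := by fun_prop
  simpa only [imp_iff_not_or] using this

@[fun_prop]
theorem DFun.all [DType M α] [DType M β] {P : α → β → Prop}
    (hP : DFun M (fun p : α × β => P p.1 p.2)) : DFun M (fun x => ∀ y, P x y) := by
  have : DFun M (fun x => ¬ ∃ y, ¬ P x y) := by fun_prop
  simpa only [not_exists, not_not] using this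

@[fun_prop]
theorem DFun.eq [DType M α] [DType M β] {f g : α → β} (hf : DFun M f) (hg : DFun M g) :
    DFun M (fun x => f x = g x) := by
  have : DFun M (fun p : β × β => p.1 = p.2) := by
    rw [dFun_iff_dPred]
    unfold DPred
    have h := dFun_id (M := M) (α := β)
    unfold DFun at h
    convert h using 1
    ext m
    simp [code_pair]
  exact this.comp (hf.prodMk hg)

@[fun_prop]
theorem DFun.mem [DType M α] {f g : α → M} (hf : DFun M f) (hg : DFun M g) :
    DFun M (fun x => f x ∈ₛ g x) := by
  have : DFun M (fun p : M × M => p.1 ∈ₛ p.2) := by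
    rw [dFun_iff_dPred]
    unfold DPred
    convert (((rawDef_mem (M := M) 1 2).and (rawDef_eq_pair 0 1 2)).ex 2).ex 1
      |>.definable₁ using 1
    ext m
    simp [update, Coded.code]
    grind
  exact this.comp (hf.prodMk hg)

/-- A pair is coded by the ordered pair of the codes, so both hypotheses describe the same class.
This makes any function given by a definable characterization of its values definable, in particular
one obtained by `choose`. -/
theorem DFun.of_graph [DType M α] [DType M β] {f : α → β}
    (h : DFun M (fun p : α × β => p.2 = f p.1)) : DFun M f := by
  rw [dFun_iff_dPred] at h
  unfold DFun
  unfold DPred at h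
  convert h using 1
  ext m
  simp [code_pair]

@[fun_prop]
theorem DFun.ite [DType M α] [DType M β] {P : α → Prop} [∀ x, Decidable (P x)] {f g : α → β}
    (hP : DFun M P) (hf : DFun M f) (hg : DFun M g) :
    DFun M (fun x => if P x then f x else g x) := by
  have : DFun M (fun p : α × β => (P p.1 ∧ p.2 = f p.1) ∨ (¬ P p.1 ∧ p.2 = g p.1)) := by fun_prop
  refine DFun.of_graph (Eq.mp (congrArg _ ?_) this)
  ext p
  split_ifs with h <;> simp [h]

end DefinableFunctions

end ZFModel

namespace ZFModel

open Function

/-! ### From definable functions to sets of the model -/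

section InternalFunctions

variable {M : Type u} [setLang.Structure M] [ZFModel M]
variable {α : Type*} {β : Type*} {γ : Type*} [Coded M α] [Coded M β] [Coded M γ]

theorem exists_sep {P : M → Prop} (hP : DFun M P) (a : M) :
    ∃ c : M, ∀ z, z ∈ₛ c ↔ z ∈ₛ a ∧ P z := by
  have h := hP.dPred
  have : {m : M | ∃ a : M, m = Coded.code a ∧ P a} = {m | P m} := by
    ext m
    simp [Coded.code]
  rw [DPred, this] at h
  exact separation _ h a

theorem dType_of_iff {P : M → Prop} (hP : DFun M P) (h : ∀ m, P m ↔ ∃ a : α, m = Coded.code a) :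
    DType M α := by
  refine ⟨Eq.mp (congrArg _ ?_) hP.dPred⟩
  ext m
  simp [← h, Coded.code]

theorem sType_of_iff {P : M → Prop} (hP : DFun M P) (s : M)
    (h : ∀ m, m ∈ₛ s ∧ P m ↔ ∃ a : α, m = Coded.code a) : SType M α := by
  obtain ⟨c, hc⟩ := exists_sep hP s
  exact ⟨c, fun m => (hc m).trans (h m)⟩

theorem dFun_code [DType M α] : DFun M (Coded.code : α → M) :=
  dFun_id (M := M) (α := α)

@[fun_prop]
theorem DFun.code [DType M α] {f : γ → α} (hf : DFun M f) :
    DFun M (fun x => (Coded.code (f x) : M)) := dFun_code.comp hf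

@[fun_prop]
theorem DFun.val {p : M → Prop} [DType M {x : M // p x}] {f : γ → {x : M // p x}}
    (hf : DFun M f) : DFun M (fun x => (f x).1) := dFun_code.comp hf

-- An element of a subtype has the same code as its underlying element, so the graph does not
-- change.
@[fun_prop]
theorem DFun.subtypeMk {p : M → Prop} {f : γ → M} (hf : DFun M f) (h : ∀ x, p (f x)) :
    DFun M (fun x => (⟨f x, h x⟩ : {x : M // p x})) := hf

@[fun_prop]
theorem DFun.pair [DType M γ] {f g : γ → M} (hf : DFun M f) (hg : DFun M g) :
    DFun M (fun x => pair (f x) (g x)) := by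
  have : DFun M (fun p : M × M => ZFModel.pair p.1 p.2) := dFun_id (M := M) (α := M × M)
  exact this.comp (hf.prodMk hg)

/-- This is Replacement, phrased for functions on a coded type. -/
theorem exists_image [SType M α] {f : α → M} (hf : DFun M f) :
    ∃ c : M, ∀ y, y ∈ₛ c ↔ ∃ a, y = f a := by
  obtain ⟨s, hs⟩ := SType.exists_set (M := M) (α := α)
  have hD : Set.Definable₂ Set.univ setLang {q : M × M | ∃ a : α, q = (Coded.code a, f a)} := by
    convert ((rawDef_mem_definable hf 2).and (rawDef_eq_pair 2 0 1)).ex 2 |>.definable₂ using 1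
    ext ⟨m, n⟩
    simp only [Set.mem_ofPred_eq, Prod.mk.injEq]
    constructor
    · rintro ⟨a, rfl, rfl⟩
      exact ⟨ZFModel.pair (Coded.code a) (f a), by simpa [Coded.code] using ⟨a, rfl⟩⟩
    · rintro ⟨y, h⟩
      simp at h
      obtain ⟨⟨a, rfl⟩, h⟩ := h
      obtain ⟨h1, h2⟩ := pair_inj h
      exact ⟨a, h1.symm, h2.symm⟩
  obtain ⟨c, hc⟩ := replacement _ hD s (by
    intro x hx
    obtain ⟨a, rfl⟩ := (hs x).1 hx
    refine ⟨f a, ⟨a, rfl⟩, ?_⟩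
    rintro y ⟨b, hb⟩
    obtain ⟨h1, rfl⟩ := Prod.mk.inj hb
    rw [code_inj] at h1
    rw [h1])
  refine ⟨c, fun y => (hc y).trans ?_⟩
  constructor
  · rintro ⟨x, hx, a, ha⟩
    exact ⟨a, (Prod.mk.inj ha).2⟩
  · rintro ⟨a, rfl⟩
    exact ⟨Coded.code a, (hs _).2 ⟨a, rfl⟩, a, rfl⟩

/-- Replacement makes each slice `{a} × β` a set, then the family of slices a set, and Union
finishes. -/
instance sTypeProd [SType M α] [SType M β] : SType M (α × β) := by
  have h1 : ∀ a : α, ∃ c : M, ∀ y, y ∈ₛ c ↔ ∃ b : β, y = pair (Coded.code a) (Coded.code b) :=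
    fun a => exists_image (by fun_prop)
  choose r hr using h1
  have h2 : DFun M r := by
    refine DFun.of_graph ?_
    have : DFun M (fun p : α × M => ∀ y : M, y ∈ₛ p.2 ↔
        ∃ b : β, y = pair (Coded.code p.1) (Coded.code b)) := by fun_prop
    convert this using 2 with p
    simp only [eq_iff_mem p.2, hr]
  obtain ⟨c, hc⟩ := exists_image h2
  obtain ⟨d, hd⟩ := union c
  refine ⟨d, fun m => (hd m).trans ?_⟩
  constructor
  · rintro ⟨y, hy, hm⟩
    obtain ⟨a, rfl⟩ := (hc y).1 hy
    obtain ⟨b, rfl⟩ := (hr a m).1 hm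
    exact ⟨(a, b), rfl⟩
  · rintro ⟨⟨a, b⟩, rfl⟩
    exact ⟨r a, (hc _).2 ⟨a, rfl⟩, (hr a _).2 ⟨b, rfl⟩⟩

theorem Internal.dFun {f : α → β} (hf : Internal M f) : DFun M f := by
  obtain ⟨g, hg⟩ := hf
  unfold DFun
  convert ((rawDef_mem (M := M) 0 1).and (rawDef_eq_const 1 g)).ex 1 |>.definable₁ using 1
  ext m
  simp [hg]

/-- By Replacement the graph of a definable function on a set is a set. With `Internal.dFun`,
definable and internal agree on set-sized domains. -/
theorem DFun.internal [SType M α] [DType M β] {f : α → β} (hf : DFun M f) : Internal M f :=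
  exists_image (f := fun a => ZFModel.pair (Coded.code a) (Coded.code (f a))) (by fun_prop)

variable (M) in
/-- The functions from `α` to `β` that belong to the model. -/
structure IFun (α : Type*) (β : Type*) [Coded M α] [Coded M β] where
  toFun : α → β
  internal : Internal M toFun

instance : CoeFun (IFun M α β) (fun _ => α → β) := ⟨IFun.toFun⟩

noncomputable instance codedIFun : Coded M (IFun M α β) where
  code f := graph f.internal
  code_injective f g h := by
    cases f; cases g
    congr
    exact graph_inj _ _ h

theorem mem_graph {f : α → β} (hf : Internal M f) (p : M) :
    p ∈ₛ graph hf ↔ ∃ x, p = pair (Coded.code x) (Coded.code (f x)) := hf.choose_spec p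

theorem pair_mem_graph {f : α → β} (hf : Internal M f) (a : α) (b : β) :
    pair (Coded.code a) (Coded.code b) ∈ₛ graph hf ↔ b = f a := by
  rw [mem_graph]
  constructor
  · rintro ⟨x, hx⟩
    obtain ⟨h1, h2⟩ := pair_inj hx
    rw [code_inj] at h1 h2
    rw [h2, h1]
  · rintro rfl
    exact ⟨a, rfl⟩

theorem eq_graph {f : α → β} (hf : Internal M f) {g : M}
    (hg : ∀ p, p ∈ₛ g ↔ ∃ x, p = pair (Coded.code x) (Coded.code (f x))) : g = graph hf :=
  extensionality _ _ fun p => (hg p).trans (mem_graph hf p).symm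

/-- Being a total single-valued set of pairs is first-order. This permits quantification over
internal functions inside definable conditions. -/
instance dTypeIFun [DType M α] [DType M β] : DType M (IFun M α β) := by
  refine dType_of_iff (P := fun m => (∀ p : M, p ∈ₛ m → ∃ (a : α) (b : β),
    p = pair (Coded.code a) (Coded.code b)) ∧ ∀ a : α, ∃ b : β, ∀ c : β,
      pair (Coded.code a) (Coded.code c) ∈ₛ m ↔ c = b) (by fun_prop) fun m => ?_
  constructor
  · rintro ⟨h1, h2⟩
    choose f hf using h2
    have hg : ∀ p, p ∈ₛ m ↔ ∃ x, p = pair (Coded.code x) (Coded.code (f x)) := by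
      intro p
      constructor
      · intro hp
        obtain ⟨a, b, rfl⟩ := h1 p hp
        exact ⟨a, by rw [(hf a b).1 hp]⟩
      · rintro ⟨a, rfl⟩
        exact (hf a _).2 rfl
    exact ⟨⟨f, m, hg⟩, eq_graph _ hg⟩
  · rintro ⟨f, rfl⟩
    refine ⟨fun p hp => ?_, fun a => ⟨f a, fun c => pair_mem_graph f.internal a c⟩⟩
    obtain ⟨x, hx⟩ := (mem_graph f.internal p).1 hp
    exact ⟨x, _, hx⟩

/-- Evaluation is definable for objects coded by the graphs of functions. -/
theorem dFun_eval_of_graph {δ : Type*} [Coded M δ] [DType M δ] [DType M α] [DType M β]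
    (e : δ → α → β)
    (he : ∀ d a b, pair (Coded.code a) (Coded.code b) ∈ₛ (Coded.code d : M) ↔ b = e d a) :
    DFun M (fun p : δ × α => e p.1 p.2) := by
  refine DFun.of_graph ?_
  have : DFun M (fun p : (δ × α) × β =>
    pair (Coded.code p.1.2) (Coded.code p.2) ∈ₛ (Coded.code p.1.1 : M)) := by fun_prop
  convert this using 2 with p
  rw [he]

@[fun_prop]
theorem DFun.iFunEval [DType M α] [DType M β] {F : γ → IFun M α β} {x : γ → α}
    (hF : DFun M F) (hx : DFun M x) : DFun M (fun p => (F p).toFun (x p)) :=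
  (dFun_eval_of_graph (fun (f : IFun M α β) a => f a)
    (fun f a b => pair_mem_graph f.internal a b)).comp (hF.prodMk hx)

/-- The internal function with a given definable rule. -/
def DFun.toIFun [SType M α] [DType M β] {f : α → β} (hf : DFun M f) : IFun M α β := ⟨f, hf.internal⟩

end InternalFunctions

end ZFModel

namespace ZFModel

open Function

/-! ### Natural numbers of the model -/

section NaturalNumbers

variable {M : Type u} [setLang.Structure M] [ZFModel M]
variable {α : Type*} {β : Type*} {γ : Type*} [Coded M α] [Coded M β] [Coded M γ]

@[fun_prop]
theorem DFun.succ [DType M γ] {f : γ → M} (hf : DFun M f) : DFun M (fun x => succ (f x)) := by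
  have h1 : DFun M (ZFModel.succ : M → M) := by
    refine DFun.of_graph ?_
    have : DFun M (fun p : M × M => ∀ z : M, z ∈ₛ p.2 ↔ z ∈ₛ p.1 ∨ z = p.1) := by fun_prop
    convert this using 2 with p
    simp only [eq_iff_mem p.2, mem_succ]
  exact h1.comp hf

theorem dFun_isNat : DFun M (IsNat : M → Prop) := by
  have : DFun M (fun n : M => ∀ c : M, empty ∈ₛ c → (∀ k, k ∈ₛ c → ZFModel.succ k ∈ₛ c) → n ∈ₛ c) := by
    fun_prop
  exact this

instance sTypeOmega : SType M (Omega M) := by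
  obtain ⟨c, ⟨e, he, he'⟩, hs⟩ := infinity (M := M)
  have h0 : empty ∈ₛ c := by
    rwa [show (empty : M) = e from extensionality _ _ fun z =>
      iff_of_false (not_mem_empty z) (he' z)]
  have h1 : ∀ k, k ∈ₛ c → ZFModel.succ k ∈ₛ c := by
    intro k hk
    obtain ⟨s, hs1, hs2⟩ := hs k hk
    rwa [show ZFModel.succ k = s from extensionality _ _ fun z => mem_succ.trans (hs2 z).symm]
  exact sType_of_iff dFun_isNat c fun m =>
    ⟨fun h => ⟨⟨m, h.2⟩, rfl⟩, by rintro ⟨a, rfl⟩; exact ⟨a.2 c h0 h1, a.2⟩⟩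

/-- Separation makes the numbers with property `P` a set, and this set is inductive. Definability of
`P` is essential, since `M` may have nonstandard natural numbers. -/
theorem Omega.induction {P : Omega M → Prop} (hP : DFun M P) (h0 : P Omega.zero)
    (h1 : ∀ k, P k → P k.succ) (n : Omega M) : P n := by
  obtain ⟨s, hs⟩ := SType.exists_set (M := M) (α := Omega M)
  obtain ⟨c, hc⟩ := exists_sep (P := fun m => ∃ k : Omega M, k.1 = m ∧ P k) (by fun_prop) s
  obtain ⟨-, k, hk, h⟩ := (hc n.1).1 (n.2 c
    ((hc _).2 ⟨(hs _).2 ⟨Omega.zero, rfl⟩, Omega.zero, rfl, h0⟩) (by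
      intro k hk
      obtain ⟨-, k, rfl, h⟩ := (hc k).1 hk
      exact (hc _).2 ⟨(hs _).2 ⟨k.succ, rfl⟩, k.succ, rfl, h1 k h⟩))
  rwa [← Subtype.ext hk]

theorem Omega.mem_trans (n : Omega M) : ∀ k m : M, k ∈ₛ n.1 → m ∈ₛ k → m ∈ₛ n.1 := by
  refine Omega.induction (P := fun n => ∀ k m : M, k ∈ₛ n.1 → m ∈ₛ k → m ∈ₛ n.1)
    (by fun_prop) (fun k m h => (not_mem_empty k h).elim) (fun n ih k m hk hm => ?_) n
  rcases mem_succ.1 hk with hk | rfl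
  · exact mem_succ.2 (Or.inl (ih k m hk hm))
  · exact mem_succ.2 (Or.inl hm)

theorem not_mem_self (x : M) : ¬ x ∈ₛ x := by
  intro h
  obtain ⟨y, hy, h'⟩ := foundation (upair x x) ⟨x, mem_upair.2 (Or.inl rfl)⟩
  obtain rfl : y = x := by simpa [mem_upair] using hy
  exact h' y h hy

theorem Omega.mem_of_succ_mem_succ {n k : Omega M} (h : k.succ.1 ∈ₛ n.succ.1) : k.1 ∈ₛ n.1 := by
  rcases mem_succ.1 h with h | h
  · exact n.mem_trans _ _ h (mem_succ.2 (Or.inr rfl))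
  · rw [← h]
    exact mem_succ.2 (Or.inr rfl)

end NaturalNumbers

/-! ### Finite sets of the model -/

section FiniteSets

variable {M : Type u} [setLang.Structure M] [ZFModel M]

theorem exists_adjoin (x a : M) : ∃ s : M, ∀ z, z ∈ₛ s ↔ z ∈ₛ a ∨ z = x := by
  obtain ⟨s, hs⟩ := union (upair a (upair x x))
  refine ⟨s, fun z => (hs z).trans ?_⟩
  simp only [mem_upair]
  constructor
  · rintro ⟨y, rfl | rfl, h⟩
    · exact Or.inl h
    · exact Or.inr (by simpa [mem_upair] using h)
  · rintro (h | rfl)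
    · exact ⟨a, Or.inl rfl, h⟩
    · exact ⟨_, Or.inr rfl, mem_upair.2 (Or.inl rfl)⟩

/-- `a ∪ {x}`. -/
noncomputable def adjoin (x a : M) : M := (exists_adjoin x a).choose

theorem mem_adjoin {x a z : M} : z ∈ₛ adjoin x a ↔ z ∈ₛ a ∨ z = x :=
  (exists_adjoin x a).choose_spec z

theorem isFin_empty : IsFin (empty : M) := by
  refine ⟨Omega.zero, fun x => x, dFun_id.internal, Function.bijective_id⟩

theorem isFin_adjoin_of_not_mem {x a : M} (ha : IsFin a) (hx : ¬ x ∈ₛ a) : IsFin (adjoin x a) := by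
  classical
  obtain ⟨n, e, he, hb⟩ := ha
  have hd := he.dFun
  -- The enumeration of `a` is extended by giving `x` the last number, which is `n` itself.
  let f : El n.succ.1 → El (adjoin x a) := fun k =>
    if h : k.1 ∈ₛ n.1 then ⟨(e ⟨k.1, h⟩).1, mem_adjoin.2 (Or.inl (e ⟨k.1, h⟩).2)⟩
    else ⟨x, mem_adjoin.2 (Or.inr rfl)⟩
  have hf : DFun M f := by
    refine DFun.of_graph ?_
    have : DFun M (fun p : El n.succ.1 × El (adjoin x a) =>
      (∃ k : El n.1, k.1 = p.1.1 ∧ (e k).1 = p.2.1) ∨ (p.1.1 = n.1 ∧ p.2.1 = x)) := by fun_prop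
    convert this using 2 with p
    obtain ⟨⟨k, hk⟩, ⟨y, hy⟩⟩ := p
    simp only [f, Subtype.ext_iff]
    by_cases h : k ∈ₛ n.1
    · have h1 : k ≠ n.1 := by rintro rfl; exact not_mem_self _ h
      simp only [h, h1, dite_true, false_and, or_false]
      exact ⟨fun h' => ⟨⟨k, h⟩, rfl, h'.symm⟩, by rintro ⟨⟨_, _⟩, rfl, h2⟩; exact h2.symm⟩
    · have h1 : k = n.1 := (mem_succ.1 hk).resolve_left h
      subst h1
      simp only [h, dite_false]
      refine ⟨fun h' => Or.inr ⟨trivial, h'⟩, ?_⟩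
      rintro (⟨⟨k, hk⟩, rfl, _⟩ | ⟨-, h'⟩)
      · exact (h hk).elim
      · exact h'
  refine ⟨n.succ, f, hf.internal, ?_, ?_⟩
  · rintro ⟨k, hk⟩ ⟨l, hl⟩ h
    simp only [f, Subtype.ext_iff] at h ⊢
    by_cases h1 : k ∈ₛ n.1 <;> by_cases h2 : l ∈ₛ n.1 <;> simp only [h1, h2, dite_true, dite_false] at h
    · exact congrArg Subtype.val (hb.1 (Subtype.ext h))
    · exact (hx (h ▸ (e _).2)).elim
    · exact (hx (h ▸ (e _).2)).elim
    · rw [(mem_succ.1 hk).resolve_left h1, (mem_succ.1 hl).resolve_left h2]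
  · rintro ⟨y, hy⟩
    rcases mem_adjoin.1 hy with hy' | rfl
    · obtain ⟨k, hk⟩ := hb.2 ⟨y, hy'⟩
      refine ⟨⟨k.1, mem_succ.2 (Or.inl k.2)⟩, ?_⟩
      simp [f, k.2, hk]
    · refine ⟨⟨n.1, mem_succ.2 (Or.inr rfl)⟩, ?_⟩
      simp [f, not_mem_self]

theorem isFin_adjoin {x a : M} (ha : IsFin a) : IsFin (adjoin x a) := by
  by_cases hx : x ∈ₛ a
  · rwa [show adjoin x a = a from extensionality _ _ fun z => by
      rw [mem_adjoin]; exact ⟨by rintro (h | rfl) <;> assumption, Or.inl⟩]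
  · exact isFin_adjoin_of_not_mem ha hx

/-- The definition quantifies over Lean functions. Replacing the bijection by its graph leaves a
first-order condition, from which definability can be read off. -/
theorem isFin_iff (a : M) : IsFin a ↔ ∃ n : Omega M, ∃ g : M,
    (∀ p, p ∈ₛ g → ∃ x y : M, x ∈ₛ n.1 ∧ y ∈ₛ a ∧ p = pair x y) ∧
    (∀ x, x ∈ₛ n.1 → ∃ y, y ∈ₛ a ∧ ∀ z, pair x z ∈ₛ g ↔ z = y) ∧
    (∀ y, y ∈ₛ a → ∃ x, x ∈ₛ n.1 ∧ pair x y ∈ₛ g) ∧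
    (∀ x x' y, pair x y ∈ₛ g → pair x' y ∈ₛ g → x = x') := by
  constructor
  · rintro ⟨n, e, ⟨g, hg⟩, hb⟩
    have key : ∀ x y, pair x y ∈ₛ g ↔ ∃ k : El n.1, k.1 = x ∧ (e k).1 = y := by
      intro x y
      rw [hg]
      exact exists_congr fun k => by rw [pair_eq_iff]; exact and_congr eq_comm eq_comm
    refine ⟨n, g, fun p hp => ?_, fun x hx => ?_, fun y hy => ?_, ?_⟩
    · obtain ⟨k, rfl⟩ := (hg p).1 hp
      exact ⟨_, _, k.2, (e k).2, rfl⟩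
    · refine ⟨e ⟨x, hx⟩, (e _).2, fun z => (key _ _).trans ⟨?_, ?_⟩⟩
      · rintro ⟨k, rfl, rfl⟩; rfl
      · rintro rfl; exact ⟨⟨x, hx⟩, rfl, rfl⟩
    · obtain ⟨k, hk⟩ := hb.2 ⟨y, hy⟩
      exact ⟨k.1, k.2, (key _ _).2 ⟨k, rfl, by rw [hk]⟩⟩
    · rintro x x' y h h'
      obtain ⟨k, rfl, hk⟩ := (key _ _).1 h
      obtain ⟨k', rfl, hk'⟩ := (key _ _).1 h'
      exact congrArg _ (hb.1 (Subtype.ext (hk.trans hk'.symm)))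
  · rintro ⟨n, g, h1, h2, h3, h4⟩
    choose! f hf hf' using h2
    refine ⟨n, fun k => ⟨f k.1, hf k.1 k.2⟩, ⟨g, fun p => ⟨fun hp => ?_, ?_⟩⟩, ?_, ?_⟩
    · obtain ⟨x, y, hx, hy, rfl⟩ := h1 p hp
      refine ⟨⟨x, hx⟩, ?_⟩
      rw [(hf' x hx y).1 hp]
      rfl
    · rintro ⟨k, rfl⟩
      exact (hf' k.1 k.2 _).2 rfl
    · rintro k l h
      have h := congrArg Subtype.val h
      exact Subtype.ext (h4 _ _ _ ((hf' k.1 k.2 _).2 rfl) ((hf' l.1 l.2 _).2 h))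
    · rintro ⟨y, hy⟩
      obtain ⟨x, hx, h⟩ := h3 y hy
      exact ⟨⟨x, hx⟩, Subtype.ext ((hf' x hx y).1 h).symm⟩

theorem dFun_isFin : DFun M (IsFin : M → Prop) := by
  rw [show (IsFin : M → Prop) = _ from funext fun a => propext (isFin_iff a)]
  fun_prop

instance sTypeFinSub (X : M) : SType M (FinSub X) := by
  obtain ⟨s, hs⟩ := powerset X
  refine sType_of_iff dFun_isFin s fun m => ?_
  rw [hs]
  exact ⟨fun h => ⟨⟨m, h⟩, rfl⟩, by rintro ⟨a, rfl⟩; exact a.2⟩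

@[fun_prop]
theorem DFun.adjoin {γ : Type*} [Coded M γ] [DType M γ] {f g : γ → M} (hf : DFun M f)
    (hg : DFun M g) : DFun M (fun x => adjoin (f x) (g x)) := by
  have h1 : DFun M (fun p : M × M => ZFModel.adjoin p.1 p.2) := by
    refine DFun.of_graph ?_
    have : DFun M (fun p : (M × M) × M => ∀ z : M, z ∈ₛ p.2 ↔ z ∈ₛ p.1.2 ∨ z = p.1.1) := by
      fun_prop
    convert this using 2 with p
    simp only [eq_iff_mem p.2, mem_adjoin]
  have h := h1.comp (hf.prodMk hg)
  exact h

namespace FinSub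

variable {X Y : M}

theorem ext {F G : FinSub X} (h : ∀ x : El X, x.1 ∈ₛ F.1 ↔ x.1 ∈ₛ G.1) : F = G :=
  Subtype.ext (extensionality _ _ fun z =>
    ⟨fun hz => (h ⟨z, F.2.1 z hz⟩).1 hz, fun hz => (h ⟨z, G.2.1 z hz⟩).2 hz⟩)

variable (X) in
/-- The empty set as a finite subset of `X`. -/
noncomputable def empty : FinSub X := ⟨ZFModel.empty, fun x hx => (not_mem_empty x hx).elim, isFin_empty⟩

/-- `F ∪ {x}`. -/
noncomputable def insert (x : El X) (F : FinSub X) : FinSub X :=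
  ⟨adjoin x.1 F.1, fun z hz => by
    rcases mem_adjoin.1 hz with h | rfl
    exacts [F.2.1 z h, x.2], isFin_adjoin F.2.2⟩

theorem not_mem_empty (x : El X) : ¬ x.1 ∈ₛ (empty X).1 := ZFModel.not_mem_empty x.1

theorem mem_insert {x y : El X} {F : FinSub X} : y.1 ∈ₛ (insert x F).1 ↔ y.1 ∈ₛ F.1 ∨ y = x := by
  rw [Subtype.ext_iff]
  exact mem_adjoin

end FinSub

@[fun_prop]
theorem DFun.finSubInsert {X : M} {γ : Type*} [Coded M γ] [DType M γ] {x : γ → El X}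
    {F : γ → FinSub X} (hx : DFun M x) (hF : DFun M F) :
    DFun M (fun p => FinSub.insert (x p) (F p)) := by
  have h : DFun M (fun p => ZFModel.adjoin (x p).1 (F p).1) := by fun_prop
  exact h.subtypeMk fun p => (FinSub.insert (x p) (F p)).2

namespace FinSub

variable {X Y : M}

theorem induction {P : FinSub X → Prop} (hP : DFun M P) (h0 : P (empty X))
    (h1 : ∀ F x, ¬ x.1 ∈ₛ F.1 → P F → P (insert x F)) (F : FinSub X) : P F := by
  obtain ⟨n, e, he, hb⟩ := F.2.2
  have hd := he.dFun
  -- Induction along an enumeration of `F`: each initial segment `e(0), …, e(k - 1)` is a finite set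
  -- with property `P`. The bound `k ≤ n` is written as membership in the successor of `n`.
  have key : ∀ k : Omega M, k.1 ∈ₛ n.succ.1 → ∃ A : FinSub X, P A ∧
      ∀ x : El X, x.1 ∈ₛ A.1 ↔ ∃ j : El n.1, j.1 ∈ₛ k.1 ∧ x.1 = (e j).1 := by
    refine Omega.induction (by fun_prop) (fun _ => ⟨empty X, h0, fun x => ?_⟩) fun k ih hk => ?_
    · refine iff_of_false (not_mem_empty x) ?_
      rintro ⟨j, hj, -⟩
      exact ZFModel.not_mem_empty _ hj
    · have hkn := Omega.mem_of_succ_mem_succ hk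
      obtain ⟨A, hA, hA'⟩ := ih (mem_succ.2 (Or.inl hkn))
      let y : El X := ⟨(e ⟨k.1, hkn⟩).1, F.2.1 _ (e ⟨k.1, hkn⟩).2⟩
      refine ⟨insert y A, h1 A y (fun hy => ?_) hA, fun x => ?_⟩
      · obtain ⟨j, hj, h⟩ := (hA' y).1 hy
        have h := hb.1 (Subtype.ext h)
        rw [← h] at hj
        exact not_mem_self _ hj
      · rw [mem_insert, hA']
        constructor
        · rintro (⟨j, hj, h⟩ | rfl)
          · exact ⟨j, mem_succ.2 (Or.inl hj), h⟩
          · exact ⟨⟨k.1, hkn⟩, mem_succ.2 (Or.inr rfl), rfl⟩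
        · rintro ⟨j, hj, h⟩
          rcases mem_succ.1 hj with hj | hj
          · exact Or.inl ⟨j, hj, h⟩
          · refine Or.inr (Subtype.ext ?_)
            rw [h]
            simp only [y]
            congr 2
            exact Subtype.ext hj
  obtain ⟨A, hA, hA'⟩ := key n (mem_succ.2 (Or.inr rfl))
  suffices h : F = A by rwa [h]
  refine ext fun x => ?_
  rw [hA']
  constructor
  · intro hx
    obtain ⟨j, hj⟩ := hb.2 ⟨x.1, hx⟩
    exact ⟨j, j.2, by rw [hj]⟩
  · rintro ⟨j, hj, h⟩
    rw [h]
    exact (e j).2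

theorem isFin_of_subset (F : FinSub X) : ∀ a : M, (∀ z, z ∈ₛ a → z ∈ₛ F.1) → IsFin a := by
  have hfin := dFun_isFin (M := M)
  refine FinSub.induction (P := fun F => ∀ a : M, (∀ z, z ∈ₛ a → z ∈ₛ F.1) → IsFin a)
    (by fun_prop) (fun a ha => ?_) (fun F x _ ih a ha => ?_) F
  · rw [show a = ZFModel.empty from extensionality _ _ fun z =>
      iff_of_false (fun h => ZFModel.not_mem_empty _ (ha z h)) (ZFModel.not_mem_empty z)]
    exact isFin_empty
  · obtain ⟨b, hb⟩ := exists_sep (P := fun z => z ≠ x.1) (by simp only [ne_eq]; fun_prop) a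
    have hb' : IsFin b := ih b fun z hz =>
      (mem_adjoin.1 (ha z ((hb z).1 hz).1)).resolve_right ((hb z).1 hz).2
    by_cases hx : x.1 ∈ₛ a
    · rw [show a = adjoin x.1 b from extensionality _ _ fun z => by
        rw [mem_adjoin, hb]
        by_cases hz : z = x.1 <;> simp [hz, hx]]
      exact isFin_adjoin hb'
    · rwa [show a = b from extensionality _ _ fun z => by
        rw [hb, iff_self_and]
        rintro h rfl
        exact hx h]

/-- Separation yields the set, and finiteness passes to subsets. This is the standard way below to
build a finite set from a definable property. -/
theorem exists_of_bounded {P : El X → Prop} (hP : DFun M P) (F : FinSub X)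
    (h : ∀ x, P x → x.1 ∈ₛ F.1) : ∃ A : FinSub X, ∀ x : El X, x.1 ∈ₛ A.1 ↔ P x := by
  obtain ⟨a, ha⟩ := exists_sep (P := fun z => ∃ x : El X, x.1 = z ∧ P x) (by fun_prop) X
  refine ⟨⟨a, fun z hz => ((ha z).1 hz).1, isFin_of_subset F a fun z hz => ?_⟩, fun x => ?_⟩
  · obtain ⟨-, x, rfl, hx⟩ := (ha z).1 hz
    exact h x hx
  · rw [ha]
    constructor
    · rintro ⟨-, y, hy, h⟩
      rwa [← Subtype.ext hy]
    · exact fun h => ⟨x.2, x, rfl, h⟩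

theorem exists_union (F G : FinSub X) :
    ∃ A : FinSub X, ∀ x : El X, x.1 ∈ₛ A.1 ↔ x.1 ∈ₛ F.1 ∨ x.1 ∈ₛ G.1 := by
  refine FinSub.induction (P := fun F => ∃ A : FinSub X, ∀ x : El X,
    x.1 ∈ₛ A.1 ↔ x.1 ∈ₛ F.1 ∨ x.1 ∈ₛ G.1) (by fun_prop) ⟨G, fun x => ?_⟩ ?_ F
  · simp [not_mem_empty]
  · rintro F x - ⟨A, hA⟩
    exact ⟨insert x A, fun y => by rw [mem_insert, mem_insert, hA]; tauto⟩

theorem exists_biUnion {H : El Y → FinSub X} (hH : DFun M H) (F : FinSub Y) :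
    ∃ A : FinSub X, ∀ x : El X, x.1 ∈ₛ A.1 ↔ ∃ y : El Y, y.1 ∈ₛ F.1 ∧ x.1 ∈ₛ (H y).1 := by
  refine FinSub.induction (P := fun F => ∃ A : FinSub X, ∀ x : El X,
    x.1 ∈ₛ A.1 ↔ ∃ y : El Y, y.1 ∈ₛ F.1 ∧ x.1 ∈ₛ (H y).1) (by fun_prop) ⟨empty X, fun x => ?_⟩ ?_ F
  · simp [not_mem_empty]
  · rintro F y - ⟨A, hA⟩
    obtain ⟨B, hB⟩ := exists_union A (H y)
    refine ⟨B, fun x => ?_⟩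
    rw [hB, hA]
    simp only [mem_insert]
    grind

end FinSub

end FiniteSets

end ZFModel

namespace ZFModel

open Function

/-! ### Finite sums inside the model -/

section FiniteSums

variable {M : Type u} [setLang.Structure M] [ZFModel M]
variable {β : Type*} {γ : Type*} [Coded M β] [Coded M γ] {X Y : M}

namespace FinSub

theorem exists_erase (x : El X) (F : FinSub X) :
    ∃ A : FinSub X, ∀ y : El X, y.1 ∈ₛ A.1 ↔ y.1 ∈ₛ F.1 ∧ y ≠ x :=
  exists_of_bounded (by simp only [ne_eq]; fun_prop) F fun _ h => h.1

/-- `F \ {x}`. -/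
noncomputable def erase (x : El X) (F : FinSub X) : FinSub X := (exists_erase x F).choose

theorem mem_erase {x y : El X} {F : FinSub X} :
    y.1 ∈ₛ (erase x F).1 ↔ y.1 ∈ₛ F.1 ∧ y ≠ x := (exists_erase x F).choose_spec y

/-- By extensionality the value is determined by its members, so a definable membership relation
makes the function definable. -/
theorem dFun_of_mem [DType M γ] {F : γ → FinSub X}
    (h : DFun M (fun p : γ × El X => p.2.1 ∈ₛ (F p.1).1)) : DFun M F := by
  refine DFun.of_graph ?_
  have h' : DFun M (fun q : (γ × FinSub X) × El X => q.2.1 ∈ₛ (F q.1.1).1) :=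
    h.comp (g := fun q : (γ × FinSub X) × El X => (q.1.1, q.2)) (by fun_prop)
  have : DFun M (fun p : γ × FinSub X => ∀ z : El X, z.1 ∈ₛ p.2.1 ↔ z.1 ∈ₛ (F p.1).1) :=
    DFun.all (DFun.iff (by fun_prop) h')
  convert this using 2 with p
  exact ⟨fun h z => by rw [h], fun h => FinSub.ext h⟩

end FinSub

@[fun_prop]
theorem DFun.finSubErase [DType M γ] {x : γ → El X} {F : γ → FinSub X} (hx : DFun M x)
    (hF : DFun M F) : DFun M (fun p => FinSub.erase (x p) (F p)) := by
  refine FinSub.dFun_of_mem ?_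
  simp only [FinSub.mem_erase, ne_eq]
  fun_prop

variable (M β) in
/-- Addition is definable. -/
class DAdd [Add β] : Prop where
  dFun_add : DFun M (fun p : β × β => p.1 + p.2)

@[fun_prop]
theorem DFun.add [DType M γ] [Add β] [DAdd M β] {f g : γ → β} (hf : DFun M f) (hg : DFun M g) :
    DFun M (fun x => f x + g x) := by
  have h := (DAdd.dFun_add (M := M) (β := β)).comp (hf.prodMk hg)
  exact h

variable [AddCommMonoid β] [DType M β]

/-- On the subsets of `F`, the function `σ` is the finite sum of `g`. -/
def IsSumFun (g : El X → β) (F : FinSub X) (σ : IFun M (FinSub X) β) : Prop :=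
  σ (FinSub.empty X) = 0 ∧ ∀ (A : FinSub X) (x : El X), ¬ x.1 ∈ₛ A.1 →
    (∀ y : El X, y.1 ∈ₛ (FinSub.insert x A).1 → y.1 ∈ₛ F.1) → σ (FinSub.insert x A) = σ A + g x

theorem IsSumFun.unique {g : El X → β} {F G : FinSub X} {σ τ : IFun M (FinSub X) β}
    (hσ : IsSumFun g F σ) (hτ : IsSumFun g G τ) (A : FinSub X) :
    (∀ y : El X, y.1 ∈ₛ A.1 → y.1 ∈ₛ F.1) → (∀ y : El X, y.1 ∈ₛ A.1 → y.1 ∈ₛ G.1) →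
      σ A = τ A := by
  refine FinSub.induction (P := fun A => (∀ y : El X, y.1 ∈ₛ A.1 → y.1 ∈ₛ F.1) →
    (∀ y : El X, y.1 ∈ₛ A.1 → y.1 ∈ₛ G.1) → σ A = τ A) (by fun_prop) (fun _ _ => by rw [hσ.1, hτ.1]) (fun A x hx ih h1 h2 => ?_) A
  rw [hσ.2 A x hx h1, hτ.2 A x hx h2, ih
    (fun y hy => h1 y (FinSub.mem_insert.2 (Or.inl hy)))
    (fun y hy => h2 y (FinSub.mem_insert.2 (Or.inl hy)))]

variable [DAdd M β]

theorem dFun_isSumFun [DType M γ] {g : γ → El X → β} (hg : DFun M (fun p : γ × El X => g p.1 p.2)) :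
    DFun M (fun p : (γ × FinSub X) × IFun M (FinSub X) β => IsSumFun (g p.1.1) p.1.2 p.2) := by
  unfold IsSumFun
  fun_prop

/-- Recursion on finite sets by approximations: a summation function for the subsets of `F` is
extended to those of `F ∪ {x₀}`. -/
theorem exists_isSumFun {g : El X → β} (hg : DFun M g) (F : FinSub X) : ∃ σ, IsSumFun g F σ := by
  classical
  have hd : DFun M (fun p : FinSub X × IFun M (FinSub X) β => IsSumFun g p.1 p.2) := by
    unfold IsSumFun
    fun_prop
  refine FinSub.induction (P := fun F => ∃ σ, IsSumFun g F σ) (by fun_prop) ?_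
    (fun F x₀ hx₀ ⟨σ, hσ⟩ => ?_) F
  · refine ⟨(dFun_const (0 : β)).toIFun, rfl, fun A x _ h => ?_⟩
    exact (FinSub.not_mem_empty x (h x (FinSub.mem_insert.2 (Or.inr rfl)))).elim
  · have hs : DFun M (fun A : FinSub X => if x₀.1 ∈ₛ A.1 then σ (FinSub.erase x₀ A) + g x₀ else σ A) := by
      fun_prop
    refine ⟨hs.toIFun, ?_, fun A x hx h => ?_⟩
    · simp [DFun.toIFun, FinSub.not_mem_empty, hσ.1]
    · simp only [DFun.toIFun, FinSub.mem_insert] at h ⊢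
      by_cases hxx : x₀ = x
      · subst hxx
        have he : FinSub.erase x₀ (FinSub.insert x₀ A) = A := FinSub.ext fun y => by
          rw [FinSub.mem_erase, FinSub.mem_insert]
          by_cases hy : y = x₀
          · subst hy; simp [hx]
          · simp [hy]
        simp [hx, he]
      · by_cases hA : x₀.1 ∈ₛ A.1
        · have he : FinSub.erase x₀ (FinSub.insert x A) = FinSub.insert x (FinSub.erase x₀ A) :=
            FinSub.ext fun y => by
              simp only [FinSub.mem_erase, FinSub.mem_insert]
              grind
          simp only [hA, true_or, if_true, he]
          rw [hσ.2, add_right_comm]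
          · simp [FinSub.mem_erase, hx]
          · intro y hy
            rw [FinSub.mem_insert, FinSub.mem_erase] at hy
            rcases hy with hy | rfl
            · exact (h y (Or.inl hy.1)).resolve_right hy.2
            · exact (h y (Or.inr rfl)).resolve_right (Ne.symm hxx)
        · simp only [hA, hxx, or_self, if_false]
          refine hσ.2 A x hx ?_
          intro y hy
          refine (h y (FinSub.mem_insert.1 hy)).resolve_right ?_
          rintro rfl
          rcases FinSub.mem_insert.1 hy with hy | hy
          exacts [hA hy, hxx hy]

open Classical in
/-- The sum of the values of `g` over the finite set `F`. -/
noncomputable def fsum (g : El X → β) (F : FinSub X) : β :=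
  if h : ∃ σ, IsSumFun g F σ then h.choose F else 0

theorem IsSumFun.eq_fsum {g : El X → β} {F A : FinSub X} {σ : IFun M (FinSub X) β}
    (hg : DFun M g) (hσ : IsSumFun g F σ) (hA : ∀ y : El X, y.1 ∈ₛ A.1 → y.1 ∈ₛ F.1) :
    σ A = fsum g A := by
  have h := exists_isSumFun hg A
  rw [fsum, dif_pos h]
  exact hσ.unique h.choose_spec A hA fun _ h => h

@[fun_prop]
theorem DFun.fsum [DType M γ] {g : γ → El X → β} {F : γ → FinSub X}
    (hg : DFun M (fun p : γ × El X => g p.1 p.2)) (hF : DFun M F) :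
    DFun M (fun p => ZFModel.fsum (g p) (F p)) := by
  refine DFun.of_graph ?_
  have hg' : ∀ c, DFun M (g c) := fun c => by fun_prop
  have h1 := dFun_isSumFun hg
  -- Approximations agree where both are valid, so the sum is the value of any one of them. This is
  -- a definable description of it.
  have : DFun M (fun p : γ × β => ∃ σ : IFun M (FinSub X) β,
    IsSumFun (g p.1) (F p.1) σ ∧ p.2 = σ (F p.1)) := by
    have h2 : DFun M (fun p : (γ × β) × IFun M (FinSub X) β =>
        (((p.1.1, F p.1.1), p.2) : (γ × FinSub X) × IFun M (FinSub X) β)) := by fun_prop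
    have h3 := h1.comp h2
    fun_prop
  convert this using 2 with p
  constructor
  · intro h
    obtain ⟨σ, hσ⟩ := exists_isSumFun (hg' p.1) (F p.1)
    exact ⟨σ, hσ, h.trans (hσ.eq_fsum (hg' p.1) fun _ h => h).symm⟩
  · rintro ⟨σ, hσ, h⟩
    exact h.trans (hσ.eq_fsum (hg' p.1) fun _ h => h)

theorem fsum_empty {g : El X → β} (hg : DFun M g) : fsum g (FinSub.empty X) = 0 := by
  obtain ⟨σ, hσ⟩ := exists_isSumFun hg (FinSub.empty X)
  rw [← hσ.eq_fsum hg fun _ h => h, hσ.1]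

theorem fsum_insert {g : El X → β} (hg : DFun M g) {F : FinSub X} {x : El X} (hx : ¬ x.1 ∈ₛ F.1) :
    fsum g (FinSub.insert x F) = fsum g F + g x := by
  obtain ⟨σ, hσ⟩ := exists_isSumFun hg (FinSub.insert x F)
  rw [← hσ.eq_fsum hg fun _ h => h, hσ.2 F x hx fun _ h => h,
    hσ.eq_fsum hg fun y hy => FinSub.mem_insert.2 (Or.inl hy)]

theorem fsum_congr {g h : El X → β} (hg : DFun M g) (hh : DFun M h) (F : FinSub X) :
    (∀ x : El X, x.1 ∈ₛ F.1 → g x = h x) → fsum g F = fsum h F := by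
  refine FinSub.induction (P := fun F => (∀ x : El X, x.1 ∈ₛ F.1 → g x = h x) →
    fsum g F = fsum h F) (by fun_prop) (fun _ => by rw [fsum_empty hg, fsum_empty hh])
    (fun F x hx ih hF => ?_) F
  rw [fsum_insert hg hx, fsum_insert hh hx, hF x (FinSub.mem_insert.2 (Or.inr rfl)),
    ih fun y hy => hF y (FinSub.mem_insert.2 (Or.inl hy))]

theorem map_fsum {β' : Type*} [Coded M β'] [AddCommMonoid β'] [DType M β'] [DAdd M β']
    (φ : β →+ β') (hφ : DFun M φ) {g : El X → β} (hg : DFun M g) (F : FinSub X) :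
    φ (fsum g F) = fsum (fun x => φ (g x)) F := by
  have h : DFun M (fun x => φ (g x)) := by fun_prop
  refine FinSub.induction (P := fun F => φ (fsum g F) = fsum (fun x => φ (g x)) F)
    (by fun_prop) (by rw [fsum_empty hg, fsum_empty h, map_zero])
    (fun F x hx ih => ?_) F
  rw [fsum_insert hg hx, fsum_insert h hx, map_add, ih]

theorem fsum_add {g h : El X → β} (hg : DFun M g) (hh : DFun M h) (F : FinSub X) :
    fsum (fun x => g x + h x) F = fsum g F + fsum h F := by
  have hgh : DFun M (fun x => g x + h x) := by fun_prop
  refine FinSub.induction (P := fun F => fsum (fun x => g x + h x) F = fsum g F + fsum h F)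
    (by fun_prop) (by rw [fsum_empty hg, fsum_empty hh, fsum_empty hgh, add_zero])
    (fun F x hx ih => ?_) F
  rw [fsum_insert hg hx, fsum_insert hh hx, fsum_insert hgh hx, ih, add_add_add_comm]

theorem fsum_zero (F : FinSub X) : fsum (fun _ => (0 : β)) F = 0 := by
  have h : DFun M (fun _ : El X => (0 : β)) := by fun_prop
  refine FinSub.induction (P := fun F => fsum (fun _ => (0 : β)) F = 0) (by fun_prop)
    (fsum_empty h) (fun F x hx ih => ?_) F
  rw [fsum_insert h hx, ih, add_zero]

theorem fsum_comm {g : El X → El Y → β} (hg : DFun M (fun p : El X × El Y => g p.1 p.2))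
    (F : FinSub X) (G : FinSub Y) :
    fsum (fun x => fsum (g x) G) F = fsum (fun y => fsum (fun x => g x y) F) G := by
  have h1 : DFun M (fun x => fsum (g x) G) := by fun_prop
  refine FinSub.induction
    (P := fun F => fsum (fun x => fsum (g x) G) F = fsum (fun y => fsum (fun x => g x y) F) G)
    (by fun_prop) ?_ (fun F x hx ih => ?_) F
  · rw [fsum_empty h1]
    refine (fsum_zero G).symm.trans (fsum_congr (by fun_prop) (by fun_prop) G fun y _ => ?_)
    rw [fsum_empty (by fun_prop)]
  · rw [fsum_insert h1 hx, ih, ← fsum_add (by fun_prop) (by fun_prop)]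
    refine fsum_congr (by fun_prop) (by fun_prop) G fun y _ => ?_
    rw [fsum_insert (by fun_prop) hx]

open Classical in
theorem fsum_eq_ite {g : El X → β} (hg : DFun M g) (z : El X) (hz : ∀ x, x ≠ z → g x = 0)
    (F : FinSub X) : fsum g F = if z.1 ∈ₛ F.1 then g z else 0 := by
  refine FinSub.induction (P := fun F => fsum g F = if z.1 ∈ₛ F.1 then g z else 0) (by fun_prop)
    (by simp [fsum_empty hg, FinSub.not_mem_empty]) (fun F x hx ih => ?_) F
  rw [fsum_insert hg hx, ih]
  by_cases h : x = z
  · subst h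
    simp [hx, FinSub.mem_insert]
  · simp [FinSub.mem_insert, hz x h, Ne.symm h]

/-- The initial segments of an enumeration link the partial sums in `HasFinSum` to the recursion on
finite sets. -/
theorem exists_filtration (F : FinSub X) (n : Omega M) (e : El n.1 → El F.1) (he : Internal M e)
    (hb : Bijective e) : ∃ A : Omega M → FinSub X, DFun M A ∧ A Omega.zero = FinSub.empty X ∧
      A n = F ∧ ∀ (k : Omega M) (hk : k.1 ∈ₛ n.1), ¬ (F.incl (e ⟨k.1, hk⟩)).1 ∈ₛ (A k).1 ∧
        A k.succ = FinSub.insert (F.incl (e ⟨k.1, hk⟩)) (A k) := by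
  have hd := he.dFun
  have h1 : ∀ k : Omega M, ∃ A : FinSub X, ∀ x : El X,
      x.1 ∈ₛ A.1 ↔ ∃ j : El n.1, j.1 ∈ₛ k.1 ∧ x.1 = (e j).1 := fun k =>
    FinSub.exists_of_bounded (by fun_prop) F (by rintro x ⟨j, -, h⟩; rw [h]; exact (e j).2)
  choose A hA using h1
  refine ⟨A, FinSub.dFun_of_mem (by simp only [hA]; fun_prop), FinSub.ext fun x => ?_,
    FinSub.ext fun x => ?_, fun k hk => ⟨fun h => ?_, FinSub.ext fun x => ?_⟩⟩
  · rw [hA]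
    refine iff_of_false ?_ (FinSub.not_mem_empty x)
    rintro ⟨j, hj, -⟩
    exact not_mem_empty _ hj
  · rw [hA]
    constructor
    · rintro ⟨j, -, h⟩
      rw [h]
      exact (e j).2
    · intro hx
      obtain ⟨j, hj⟩ := hb.2 ⟨x.1, hx⟩
      exact ⟨j, j.2, by rw [hj]⟩
  · obtain ⟨j, hj, h⟩ := (hA _ _).1 h
    have h := hb.1 (Subtype.ext h)
    rw [← h] at hj
    exact not_mem_self _ hj
  · rw [FinSub.mem_insert, hA, hA]
    constructor
    · rintro ⟨j, hj, h⟩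
      rcases mem_succ.1 hj with hj | hj
      · exact Or.inl ⟨j, hj, h⟩
      · refine Or.inr (Subtype.ext ?_)
        rw [h, show j = ⟨k.1, hk⟩ from Subtype.ext hj]
        rfl
    · rintro (⟨j, hj, h⟩ | rfl)
      · exact ⟨j, mem_succ.2 (Or.inl hj), h⟩
      · exact ⟨⟨k.1, hk⟩, mem_succ.2 (Or.inr rfl), rfl⟩

theorem hasFinSum_iff {g : El X → β} (hg : DFun M g) (F : FinSub X) (c : β) :
    HasFinSum F.1 (fun x => g (F.incl x)) c ↔ c = fsum g F := by
  constructor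
  · rintro ⟨n, e, s, he, hb, hs, h0, h1, rfl⟩
    obtain ⟨A, hA, hA0, hAn, hA1⟩ := exists_filtration F n e he hb
    have hsd := hs.dFun
    have key : ∀ k : Omega M, k.1 ∈ₛ n.succ.1 → s k = fsum g (A k) := by
      refine Omega.induction (by fun_prop) (fun _ => by rw [h0, hA0, fsum_empty hg])
        fun k ih hk => ?_
      have hkn := Omega.mem_of_succ_mem_succ hk
      rw [h1 k hkn, (hA1 k hkn).2, fsum_insert hg (hA1 k hkn).1, ih (mem_succ.2 (Or.inl hkn))]
    rw [key n (mem_succ.2 (Or.inr rfl)), hAn]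
  · rintro rfl
    obtain ⟨n, e, he, hb⟩ := F.2.2
    obtain ⟨A, hA, hA0, hAn, hA1⟩ := exists_filtration F n e he hb
    have hs : DFun M (fun k => fsum g (A k)) := by fun_prop
    refine ⟨n, e, _, he, hb, hs.internal, by rw [hA0, fsum_empty hg], fun k hk => ?_, by rw [hAn]⟩
    rw [(hA1 k hk).2, fsum_insert hg (hA1 k hk).1]

end FiniteSums

end ZFModel

namespace ZFModel

open Function

/-! ### Fixed points of increasing maps on finite subsets -/

section Towers

variable {M : Type u} [setLang.Structure M] [ZFModel M] {X : M}

namespace FinSub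

/-- `A` belongs to every family that contains `A₀` and is closed under `ψ`. -/
def InTower (ψ : FinSub X → FinSub X) (A₀ A : FinSub X) : Prop :=
  ∀ C : M, A₀.1 ∈ₛ C → (∀ B : FinSub X, B.1 ∈ₛ C → (ψ B).1 ∈ₛ C) → A.1 ∈ₛ C

variable {ψ : FinSub X → FinSub X} {A₀ : FinSub X}

theorem dFun_inTower (hψ : DFun M ψ) : DFun M (InTower ψ A₀) := by
  have : DFun M (fun A : FinSub X => ∀ C : M, A₀.1 ∈ₛ C → (∀ B : FinSub X, B.1 ∈ₛ C → (ψ B).1 ∈ₛ C) →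
      A.1 ∈ₛ C) := by
    have hψ' : DFun M (fun A : FinSub X => (ψ A).1) := by fun_prop
    fun_prop
  exact this

theorem InTower.base : InTower ψ A₀ A₀ := fun _ h _ => h

theorem InTower.step {A : FinSub X} (h : InTower ψ A₀ A) : InTower ψ A₀ (ψ A) :=
  fun C h0 h1 => h1 _ (h C h0 h1)

theorem InTower.induction (hψ : DFun M ψ) {P : FinSub X → Prop} (hP : DFun M P) (h0 : P A₀)
    (h1 : ∀ A, InTower ψ A₀ A → P A → P (ψ A)) {A : FinSub X} (hA : InTower ψ A₀ A) : P A := by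
  have hT := dFun_inTower (A₀ := A₀) hψ
  obtain ⟨s, hs⟩ := SType.exists_set (M := M) (α := FinSub X)
  obtain ⟨c, hc⟩ := exists_sep
    (P := fun m => ∃ B : FinSub X, B.1 = m ∧ InTower ψ A₀ B ∧ P B) (by fun_prop) s
  obtain ⟨-, B, hB, -, h⟩ := (hc A.1).1 (hA c
    ((hc _).2 ⟨(hs _).2 ⟨A₀, rfl⟩, A₀, rfl, InTower.base, h0⟩) (by
      intro B hB
      obtain ⟨-, B', hB', h2, h3⟩ := (hc _).1 hB
      obtain rfl := Subtype.ext hB'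
      exact (hc _).2 ⟨(hs _).2 ⟨ψ B', rfl⟩, ψ B', rfl, h2.step, h1 _ h2 h3⟩))
  rwa [← Subtype.ext hB]

theorem InTower.le (hψ : DFun M ψ) (hle : ∀ A (x : El X), x.1 ∈ₛ A.1 → x.1 ∈ₛ (ψ A).1)
    {A : FinSub X} (hA : InTower ψ A₀ A) : ∀ x : El X, x.1 ∈ₛ A₀.1 → x.1 ∈ₛ A.1 :=
  InTower.induction (P := fun A => ∀ x : El X, x.1 ∈ₛ A₀.1 → x.1 ∈ₛ A.1) hψ (by fun_prop)
    (fun _ h => h) (fun A _ ih x hx => hle A x (ih x hx)) hA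

/-- Comparability as in Zermelo's and Bourbaki's treatment of towers, without indexing the iterates
by natural numbers. -/
theorem InTower.le_or_le (hψ : DFun M ψ) (hle : ∀ A (x : El X), x.1 ∈ₛ A.1 → x.1 ∈ₛ (ψ A).1)
    {A C : FinSub X} (hA : InTower ψ A₀ A) (hC : InTower ψ A₀ C) :
    (∀ x : El X, x.1 ∈ₛ A.1 → x.1 ∈ₛ C.1) ∨ (∀ x : El X, x.1 ∈ₛ (ψ C).1 → x.1 ∈ₛ A.1) := by
  have hT := dFun_inTower (A₀ := A₀) hψ
  -- Call `C` good if `ψ A ⊆ C` for every tower member `A` properly contained in `C`. A good `C`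
  -- containing `A₀` is comparable with every tower member.
  have key : ∀ C : FinSub X,
      (∀ A : FinSub X, InTower ψ A₀ A → (∀ x : El X, x.1 ∈ₛ A.1 → x.1 ∈ₛ C.1) → ¬ A = C →
        ∀ x : El X, x.1 ∈ₛ (ψ A).1 → x.1 ∈ₛ C.1) →
      ∀ {A : FinSub X}, InTower ψ A₀ A →
      (∀ x : El X, x.1 ∈ₛ A₀.1 → x.1 ∈ₛ C.1) →
      (∀ x : El X, x.1 ∈ₛ A.1 → x.1 ∈ₛ C.1) ∨ (∀ x : El X, x.1 ∈ₛ (ψ C).1 → x.1 ∈ₛ A.1) := by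
    intro C hgood A hA hC
    refine InTower.induction (P := fun A => (∀ x : El X, x.1 ∈ₛ A.1 → x.1 ∈ₛ C.1) ∨
      (∀ x : El X, x.1 ∈ₛ (ψ C).1 → x.1 ∈ₛ A.1)) hψ ?_ (Or.inl hC) (fun A hA ih => ?_) hA
    · have : DFun M (fun _ : FinSub X => (ψ C).1) := by fun_prop
      fun_prop
    · rcases ih with ih | ih
      · by_cases h : A = C
        · exact Or.inr fun x hx => by rwa [h]
        · exact Or.inl (hgood A hA ih h)
      · exact Or.inr fun x hx => hle _ _ (ih x hx)
  refine key C ?_ hA (hC.le hψ hle)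
  have hψ' : DFun M (fun A : FinSub X => (ψ A).1) := by fun_prop
  -- Every member of the tower is good, by induction along the tower.
  refine InTower.induction (P := fun C => ∀ A : FinSub X, InTower ψ A₀ A →
    (∀ x : El X, x.1 ∈ₛ A.1 → x.1 ∈ₛ C.1) → ¬ A = C →
    ∀ x : El X, x.1 ∈ₛ (ψ A).1 → x.1 ∈ₛ C.1) hψ (by fun_prop) (fun A hA h1 h2 => ?_)
    (fun C hC ih A hA h1 h2 => ?_) hC
  · exact (h2 (FinSub.ext fun x => ⟨h1 x, hA.le hψ hle x⟩)).elim
  · rcases key C ih hA (hC.le hψ hle) with h | h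
    · by_cases hAC : A = C
      · intro x hx
        rwa [← hAC]
      · exact fun x hx => hle _ _ (ih A hA h hAC x hx)
    · exact (h2 (FinSub.ext fun x => ⟨h1 x, h x⟩)).elim

end FinSub

open FinSub in
/-- An increasing function on the finite subsets of a Cohen-finite set has arbitrarily large fixed
points. -/
theorem CohenFinite.exists_fixed (hX : CohenFinite X) {ψ : FinSub X → FinSub X} (hψ : DFun M ψ)
    (hle : ∀ A (x : El X), x.1 ∈ₛ A.1 → x.1 ∈ₛ (ψ A).1) (A₀ : FinSub X) :
    ∃ A : FinSub X, (∀ x : El X, x.1 ∈ₛ A₀.1 → x.1 ∈ₛ A.1) ∧ ψ A = A := by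
  classical
  by_contra! hcon
  -- Without a fixed point above `A₀`, the map `ψ` is strictly increasing along the tower.
  have hne : ∀ A, InTower ψ A₀ A → ¬ ∀ x : El X, x.1 ∈ₛ (ψ A).1 → x.1 ∈ₛ A.1 := fun A hA h =>
    hcon A (hA.le hψ hle) (FinSub.ext fun x => ⟨h x, hle A x⟩)
  have hT := dFun_inTower (A₀ := A₀) hψ
  -- This map contradicts Dedekind-finiteness: it preserves the tower and its complement, is
  -- injective on each, and does not attain `A₀`.
  have hf : DFun M (fun A => if InTower ψ A₀ A then ψ A else A) := by fun_prop
  have hinj : ∀ A B, InTower ψ A₀ A → InTower ψ A₀ B → ψ A = ψ B → A = B := by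
    intro A B hA hB h
    rcases hA.le_or_le hψ hle hB with h1 | h1
    · rcases hB.le_or_le hψ hle hA with h2 | h2
      · exact FinSub.ext fun x => ⟨h1 x, h2 x⟩
      · exact (hne B hB (by rwa [← h])).elim
    · exact (hne A hA (by rwa [h])).elim
  obtain ⟨A, hA⟩ := hX _ hf.internal (by
    intro A B h
    dsimp only at h
    split_ifs at h with hA hB hB
    · exact hinj A B hA hB h
    · exact (hB (h ▸ hA.step)).elim
    · exact (hA (h ▸ hB.step)).elim
    · exact h) A₀
  dsimp only at hA
  split_ifs at hA with h
  · exact hne A h fun x hx => h.le hψ hle x (hA ▸ hx)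
  · exact h (hA ▸ InTower.base)

end Towers

/-! ### Real and complex arithmetic, and estimates for finite sums -/

section Numbers

variable {M : Type u} [setLang.Structure M] [ZFModel M] {R : Reals M} {X : M}
variable {γ : Type*} [Coded M γ]

instance dAddReal : DAdd M (El R.carrier) := ⟨R.add_internal.dFun⟩

@[fun_prop]
theorem DFun.realMul {f g : γ → El R.carrier} (hf : DFun M f) (hg : DFun M g) :
    DFun M (fun x => f x * g x) := by
  have h := R.mul_internal.dFun.comp (hf.prodMk hg)
  exact h

instance dTypeCplx : DType M (Cplx R) := by
  obtain ⟨s, hs⟩ := SType.exists_set (M := M) (α := El R.carrier × El R.carrier)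
  refine dType_of_iff (P := fun m => m ∈ₛ s) (by fun_prop) fun m => (hs m).trans ?_
  exact ⟨fun ⟨a, ha⟩ => ⟨⟨a.1, a.2⟩, ha⟩, fun ⟨z, hz⟩ => ⟨(z.re, z.im), hz⟩⟩

theorem dFun_toProd : DFun M (fun z : Cplx R => (z.re, z.im)) :=
  dFun_id (M := M) (α := Cplx R)

theorem DFun.cplx_of_prod {f : γ → Cplx R} (h : DFun M (fun x => ((f x).re, (f x).im))) :
    DFun M f := h

@[fun_prop]
theorem DFun.re {f : γ → Cplx R} (hf : DFun M f) : DFun M (fun x => (f x).re) :=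
  (dFun_toProd.comp hf).fst

@[fun_prop]
theorem DFun.im {f : γ → Cplx R} (hf : DFun M f) : DFun M (fun x => (f x).im) :=
  (dFun_toProd.comp hf).snd

variable [DType M γ]

@[fun_prop]
theorem DFun.realLe {f g : γ → El R.carrier} (hf : DFun M f) (hg : DFun M g) :
    DFun M (fun x => f x ≤ g x) := by
  obtain ⟨r, hr⟩ := R.le_internal
  have : DFun M (fun x => ZFModel.pair (f x).1 (g x).1 ∈ₛ r) := by fun_prop
  convert this using 2 with x
  rw [hr]
  constructor
  · exact fun h => ⟨_, _, h, rfl⟩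
  · rintro ⟨y, z, h, h'⟩
    obtain ⟨h1, h2⟩ := pair_inj h'
    rwa [Subtype.ext h1, Subtype.ext h2]

@[fun_prop]
theorem DFun.realNeg {f : γ → El R.carrier} (hf : DFun M f) : DFun M (fun x => - f x) := by
  refine DFun.of_graph ?_
  have : DFun M (fun p : γ × El R.carrier => p.2 + f p.1 = 0) := by fun_prop
  convert this using 2 with x
  exact eq_neg_iff_add_eq_zero

instance dAddCplx : DAdd M (Cplx R) := by
  refine ⟨DFun.cplx_of_prod ?_⟩
  simp only [QuadraticAlgebra.re_add, QuadraticAlgebra.im_add]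
  fun_prop

@[fun_prop]
theorem DFun.cplxMul {f g : γ → Cplx R} (hf : DFun M f) (hg : DFun M g) :
    DFun M (fun x => f x * g x) := by
  refine DFun.cplx_of_prod ?_
  simp only [QuadraticAlgebra.re_mul, QuadraticAlgebra.im_mul]
  fun_prop

@[fun_prop]
theorem DFun.cplxNeg {f : γ → Cplx R} (hf : DFun M f) : DFun M (fun x => - f x) := by
  refine DFun.cplx_of_prod ?_
  simp only [QuadraticAlgebra.re_neg, QuadraticAlgebra.im_neg]
  fun_prop

@[fun_prop]
theorem DFun.cplxSub {f g : γ → Cplx R} (hf : DFun M f) (hg : DFun M g) :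
    DFun M (fun x => f x - g x) := by
  simp only [sub_eq_add_neg]
  fun_prop

@[fun_prop]
theorem DFun.cplxStar {f : γ → Cplx R} (hf : DFun M f) : DFun M (fun x => star (f x)) := by
  refine DFun.cplx_of_prod ?_
  simp only [QuadraticAlgebra.re_star, QuadraticAlgebra.im_star]
  fun_prop

@[fun_prop]
theorem DFun.absSq {f : γ → Cplx R} (hf : DFun M f) : DFun M (fun x => absSq (f x)) := by
  simp only [ZFModel.absSq, pow_two]
  fun_prop

theorem absSq_nonneg (z : Cplx R) : 0 ≤ absSq z := by
  unfold absSq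
  positivity

theorem absSq_eq_zero {z : Cplx R} : absSq z = 0 ↔ z = 0 := by
  unfold absSq
  rw [add_eq_zero_iff_of_nonneg (sq_nonneg _) (sq_nonneg _), sq_eq_zero_iff, sq_eq_zero_iff,
    QuadraticAlgebra.ext_iff]
  rfl

theorem re_mul_star (z : Cplx R) : (z * star z).re = absSq z := by
  simp only [QuadraticAlgebra.re_mul, QuadraticAlgebra.re_star, QuadraticAlgebra.im_star, absSq]
  ring

theorem fsum_nonneg {g : El X → El R.carrier} (hg : DFun M g) (h : ∀ x, 0 ≤ g x) (F : FinSub X) :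
    0 ≤ fsum g F := by
  refine FinSub.induction (P := fun F => 0 ≤ fsum g F) (by fun_prop) (by rw [fsum_empty hg])
    (fun F x hx ih => ?_) F
  rw [fsum_insert hg hx]
  exact add_nonneg ih (h x)

theorem FinSub.insert_erase {x : El X} {F : FinSub X} (hx : x.1 ∈ₛ F.1) :
    FinSub.insert x (FinSub.erase x F) = F := FinSub.ext fun y => by
  rw [FinSub.mem_insert, FinSub.mem_erase]
  by_cases h : y = x
  · subst h; simp [hx]
  · simp [h]

theorem fsum_erase_add {β : Type*} [Coded M β] [AddCommMonoid β] [DType M β] [DAdd M β]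
    {g : El X → β} (hg : DFun M g) {x : El X} {F : FinSub X} (hx : x.1 ∈ₛ F.1) :
    fsum g (FinSub.erase x F) + g x = fsum g F := by
  rw [← fsum_insert hg (by simp [FinSub.mem_erase]), FinSub.insert_erase hx]

theorem eq_zero_of_fsum_eq_zero {g : El X → El R.carrier} (hg : DFun M g) (h : ∀ x, 0 ≤ g x)
    {F : FinSub X} (h0 : fsum g F = 0) {x : El X} (hx : x.1 ∈ₛ F.1) : g x = 0 := by
  rw [← fsum_erase_add hg hx] at h0
  exact ((add_eq_zero_iff_of_nonneg (fsum_nonneg hg h _) (h x)).1 h0).2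

theorem fsum_le_of_support {g : El X → El R.carrier} (hg : DFun M g) (h : ∀ x, 0 ≤ g x)
    (S : FinSub X) (hS : ∀ x : El X, ¬ x.1 ∈ₛ S.1 → g x = 0) (F : FinSub X) :
    fsum g F ≤ fsum g S := by
  classical
  -- Induction on `S` with `F` fixed, after truncating `g` to `S`; each new point of `S` contributes
  -- at most its value on the left.
  have key : ∀ S : FinSub X, fsum (fun x => if x.1 ∈ₛ S.1 then g x else 0) F ≤ fsum g S := by
    intro S
    have hd : ∀ S : FinSub X, DFun M (fun x : El X => if x.1 ∈ₛ S.1 then g x else 0) :=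
      fun S => by fun_prop
    refine FinSub.induction
      (P := fun S => fsum (fun x => if x.1 ∈ₛ S.1 then g x else 0) F ≤ fsum g S)
      (by fun_prop) ?_ (fun S z hz ih => ?_) S
    · rw [fsum_empty hg, fsum_congr (h := fun _ => 0) (hd _) (by fun_prop) F
        (by simp [FinSub.not_mem_empty]), fsum_zero]
    · rw [fsum_insert hg hz]
      have hz' : DFun M (fun x => if x = z then g z else 0) := by fun_prop
      have h1 : fsum (fun x => if x.1 ∈ₛ (FinSub.insert z S).1 then g x else 0) F =
          fsum (fun x => if x.1 ∈ₛ S.1 then g x else 0) F +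
            fsum (fun x => if x = z then g z else 0) F := by
        rw [← fsum_add (hd _) hz']
        refine fsum_congr (hd _) (by fun_prop) F fun x _ => ?_
        by_cases hx : x = z
        · subst hx
          simp [FinSub.mem_insert, hz]
        · simp [FinSub.mem_insert, hx]
      rw [h1]
      refine add_le_add ih ?_
      rw [fsum_eq_ite hz' z (fun x hx => by simp [hx])]
      split_ifs <;> simp [h]
  refine le_of_eq_of_le (fsum_congr hg (by fun_prop) F fun x _ => ?_) (key S)
  split_ifs with hx
  · rfl
  · exact hS x hx

theorem FinSub.exists_max {g : El X → El R.carrier} (hg : DFun M g) (F : FinSub X) :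
    (∃ x : El X, x.1 ∈ₛ F.1) →
      ∃ x : El X, x.1 ∈ₛ F.1 ∧ ∀ y : El X, y.1 ∈ₛ F.1 → g y ≤ g x := by
  refine FinSub.induction (P := fun F => (∃ x : El X, x.1 ∈ₛ F.1) →
      ∃ x : El X, x.1 ∈ₛ F.1 ∧ ∀ y : El X, y.1 ∈ₛ F.1 → g y ≤ g x) (by fun_prop) ?_ ?_ F
  · rintro ⟨x, hx⟩
    exact (not_mem_empty x hx).elim
  · rintro F x - ih -
    by_cases h : ∃ x : El X, x.1 ∈ₛ F.1
    · obtain ⟨y, hy, hy'⟩ := ih h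
      rcases le_total (g x) (g y) with hxy | hxy
      · refine ⟨y, mem_insert.2 (Or.inl hy), fun z hz => ?_⟩
        rcases mem_insert.1 hz with hz | rfl
        exacts [hy' z hz, hxy]
      · refine ⟨x, mem_insert.2 (Or.inr rfl), fun z hz => ?_⟩
        rcases mem_insert.1 hz with hz | rfl
        exacts [(hy' z hz).trans hxy, le_rfl]
    · refine ⟨x, mem_insert.2 (Or.inr rfl), fun z hz => ?_⟩
      rcases mem_insert.1 hz with hz | rfl
      exacts [(h ⟨z, hz⟩).elim, le_rfl]

end Numbers

end ZFModel

namespace ZFModel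

open Function

/-! ### Finite supports in `ℓ²(X)` and matrix entries of operators -/

section SquareSummable

variable {M : Type u} [setLang.Structure M] [ZFModel M] {R : Reals M} {X : M}
variable {γ : Type*} [Coded M γ]

/-- Completeness is available only for sets of the model, so Replacement is needed to collect the
finite sums. -/
theorem exists_isLUB_fsum {a : El X → El R.carrier} (ha : DFun M a)
    (hb : BddAbove {c | ∃ F : FinSub X, c = fsum a F}) :
    ∃ b, IsLUB {c | ∃ F : FinSub X, c = fsum a F} b := by
  obtain ⟨S, hS⟩ := exists_image (M := M) (f := fun F : FinSub X => (fsum a F).1) (by fun_prop)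
  have h : {x : El R.carrier | x.1 ∈ₛ S} = {c | ∃ F : FinSub X, c = fsum a F} := by
    ext x
    simp only [Set.mem_ofPred_eq, hS, Subtype.ext_iff]
  rw [← h] at hb ⊢
  refine R.complete S (fun x hx => ?_) ⟨_, (hS _).2 ⟨FinSub.empty X, rfl⟩⟩ hb
  obtain ⟨F, rfl⟩ := (hS x).1 hx
  exact (fsum a F).2

theorem exists_finSub_of_le {a : El X → El R.carrier} (ha : DFun M a)
    (hb : BddAbove {c | ∃ F : FinSub X, c = fsum a F}) {t : El R.carrier} (ht : 0 < t) :
    ∃ F : FinSub X, ∀ x : El X, t ≤ a x → x.1 ∈ₛ F.1 := by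
  obtain ⟨b, hb⟩ := exists_isLUB_fsum ha hb
  -- If the sum over `F` is within `t` of the supremum, adding a point outside `F` with value at
  -- least `t` would exceed it.
  obtain ⟨c, ⟨F, rfl⟩, hF, -⟩ := hb.exists_between (sub_lt_self b ht)
  refine ⟨F, fun x hx => ?_⟩
  by_contra hxF
  have h := hb.1 ⟨FinSub.insert x F, rfl⟩
  rw [fsum_insert ha hxF] at h
  linarith

theorem CohenFinite.exists_support (hX : CohenFinite X) {a : El X → El R.carrier} (ha : DFun M a)
    (h0 : ∀ x, 0 ≤ a x) (hb : BddAbove {c | ∃ F : FinSub X, c = fsum a F}) :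
    ∃ S : FinSub X, ∀ x : El X, ¬ x.1 ∈ₛ S.1 → a x = 0 := by
  have hpos : ∀ x, ¬ a x = 0 → 0 < a x := fun x hx => lt_of_le_of_ne (h0 x) (Ne.symm hx)
  -- The step adjoins the points of maximal nonzero value outside `A`. They all have value at least
  -- `a z` for any `z` outside `A` with `a z ≠ 0`, so there are finitely many; if there is no such
  -- `z`, nothing is added.
  have h1 : ∀ A : FinSub X, ∃ B : FinSub X, ∀ x : El X, x.1 ∈ₛ B.1 ↔
      x.1 ∈ₛ A.1 ∨ (¬ a x = 0 ∧ ∀ y : El X, ¬ y.1 ∈ₛ A.1 → a y ≤ a x) := by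
    intro A
    by_cases h : ∃ z : El X, ¬ z.1 ∈ₛ A.1 ∧ ¬ a z = 0
    · obtain ⟨z, hz, hz'⟩ := h
      obtain ⟨F, hF⟩ := exists_finSub_of_le ha hb (hpos z hz')
      obtain ⟨G, hG⟩ := FinSub.exists_union A F
      refine FinSub.exists_of_bounded (by fun_prop) G fun x hx => (hG x).2 ?_
      exact hx.imp id fun hx => hF x (hx.2 z hz)
    · push Not at h
      refine ⟨A, fun x => ⟨Or.inl, ?_⟩⟩
      rintro (hx | hx)
      · exact hx
      · by_contra hxA
        exact hx.1 (h x hxA)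
  choose ψ hψ using h1
  have hψd : DFun M ψ := FinSub.dFun_of_mem (by simp only [hψ]; fun_prop)
  obtain ⟨A, -, hA⟩ := hX.exists_fixed hψd (fun A x hx => (hψ A x).2 (Or.inl hx)) (FinSub.empty X)
  refine ⟨A, fun x hx => ?_⟩
  by_contra hx0
  obtain ⟨F, hF⟩ := exists_finSub_of_le ha hb (hpos x hx0)
  -- If a support point `x` lay outside the fixed set, then among the finitely many outside points
  -- with value at least `a x` a maximal one would have been adjoined.
  obtain ⟨B, hB⟩ := FinSub.exists_of_bounded (P := fun y : El X => ¬ y.1 ∈ₛ A.1 ∧ a x ≤ a y)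
    (by fun_prop) F fun y hy => hF y hy.2
  obtain ⟨z, hz, hmax⟩ := FinSub.exists_max ha B ⟨x, (hB x).2 ⟨hx, le_rfl⟩⟩
  rw [hB] at hz
  refine hz.1 ?_
  rw [← hA, hψ]
  refine Or.inr ⟨((hpos x hx0).trans_le hz.2).ne', fun y hy => ?_⟩
  rcases le_total (a x) (a y) with h | h
  · exact hmax y ((hB y).2 ⟨hy, h⟩)
  · exact h.trans hz.2

theorem squareSums_eq {f : El X → Cplx R} (hf : DFun M f) :
    squareSums f = {c | ∃ F : FinSub X, c = fsum (fun x => absSq (f x)) F} := by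
  ext c
  exact exists_congr fun F => hasFinSum_iff (g := fun x => absSq (f x)) (by fun_prop) F c

namespace L2

theorem dFun (f : L2 R X) : DFun M f.toFun := f.internal.dFun

theorem ext {f g : L2 R X} (h : ∀ x, f x = g x) : f = g := by
  cases f; cases g
  congr
  exact funext h

theorem exists_support (hX : CohenFinite X) (f : L2 R X) :
    ∃ S : FinSub X, ∀ x : El X, ¬ x.1 ∈ₛ S.1 → f x = 0 := by
  have hf := f.dFun
  have hb := f.summable
  rw [squareSums_eq hf] at hb
  obtain ⟨S, hS⟩ := hX.exists_support (by fun_prop) (fun x => absSq_nonneg (f x)) hb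
  exact ⟨S, fun x hx => absSq_eq_zero.1 (hS x hx)⟩

theorem exists_of_support {f : El X → Cplx R} (hf : DFun M f) (S : FinSub X)
    (hS : ∀ x : El X, ¬ x.1 ∈ₛ S.1 → f x = 0) : ∃ g : L2 R X, ∀ x, g x = f x := by
  refine ⟨⟨f, hf.internal, ?_⟩, fun _ => rfl⟩
  rw [squareSums_eq hf]
  refine ⟨fsum (fun x => absSq (f x)) S, ?_⟩
  rintro c ⟨F, rfl⟩
  exact fsum_le_of_support (by fun_prop) (fun x => absSq_nonneg _) S
    (fun x hx => absSq_eq_zero.2 (hS x hx)) F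

open Classical in
theorem exists_basis (x : El X) : ∃ e : L2 R X, ∀ y, e y = if y = x then 1 else 0 := by
  refine exists_of_support (by fun_prop) (FinSub.insert x (FinSub.empty X)) fun y hy => ?_
  rw [if_neg]
  rintro rfl
  exact hy (FinSub.mem_insert.2 (Or.inr rfl))

variable (R) in
/-- The characteristic function of `{x}`. -/
noncomputable def basis (x : El X) : L2 R X := (exists_basis x).choose

open Classical in
theorem basis_apply (x y : El X) : basis R x y = if y = x then 1 else 0 :=
  (exists_basis x).choose_spec y

end L2

instance dTypeL2 : DType M (L2 R X) := by
  refine dType_of_iff (P := fun m => ∃ f : IFun M (El X) (Cplx R), m = Coded.code f ∧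
    ∃ B : El R.carrier, ∀ F : FinSub X, fsum (fun x => absSq (f x)) F ≤ B) (by fun_prop) fun m => ?_
  constructor
  · rintro ⟨f, rfl, B, hB⟩
    refine ⟨⟨f, f.internal, ?_⟩, rfl⟩
    rw [squareSums_eq f.internal.dFun]
    refine ⟨B, ?_⟩
    rintro c ⟨F, rfl⟩
    exact hB F
  · rintro ⟨f, rfl⟩
    obtain ⟨B, hB⟩ := f.summable
    rw [squareSums_eq f.dFun] at hB
    exact ⟨⟨f, f.internal⟩, rfl, B, fun F => hB ⟨F, rfl⟩⟩

@[fun_prop]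
theorem DFun.l2Eval {F : γ → L2 R X} {x : γ → El X} (hF : DFun M F) (hx : DFun M x) :
    DFun M (fun p => (F p).toFun (x p)) := by
  have h := (dFun_eval_of_graph (fun (f : L2 R X) a => f a)
    (fun f a b => pair_mem_graph f.internal a b)).comp (hF.prodMk hx)
  exact h

namespace L2

theorem dFun_of_apply [DType M γ] {F : γ → L2 R X} (h : DFun M (fun p : γ × El X => F p.1 p.2)) :
    DFun M F := by
  refine DFun.of_graph ?_
  have h' : DFun M (fun q : (γ × L2 R X) × El X => F q.1.1 q.2) :=
    h.comp (g := fun q : (γ × L2 R X) × El X => (q.1.1, q.2)) (by fun_prop)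
  have : DFun M (fun p : γ × L2 R X => ∀ z : El X, p.2 z = F p.1 z) :=
    DFun.all (DFun.eq (by fun_prop) h')
  convert this using 2 with p
  exact ⟨fun h z => by rw [h], fun h => ext h⟩

theorem dFun_basis : DFun M (basis R : El X → L2 R X) := by
  classical
  refine dFun_of_apply ?_
  simp only [basis_apply]
  fun_prop

theorem hasInner_iff (f g : L2 R X) (c : Cplx R) : f.HasInner g c ↔
    ∀ ε : El R.carrier, 0 < ε → ∃ F₀ : FinSub X, ∀ F : FinSub X, (∀ x, x ∈ₛ F₀.1 → x ∈ₛ F.1) →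
      absSq (fsum (fun x => f x * star (g x)) F - c) < ε := by
  have hf := f.dFun
  have hg := g.dFun
  refine forall₂_congr fun ε _ => exists_congr fun F₀ => forall₂_congr fun F _ => ?_
  have h := hasFinSum_iff (g := fun x => f x * star (g x)) (by fun_prop) F
  exact ⟨fun h1 => h1 _ ((h _).2 rfl), fun h1 d hd => by rwa [(h d).1 hd]⟩

theorem hasInner_basis (f : L2 R X) (x : El X) : f.HasInner (basis R x) (f x) := by
  classical
  rw [hasInner_iff]
  intro ε hε
  have hf := f.dFun
  have hx := (basis R x).dFun
  refine ⟨FinSub.insert x (FinSub.empty X), fun F hF => ?_⟩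
  have hxF : x.1 ∈ₛ F.1 := hF x.1 (FinSub.mem_insert.2 (Or.inr rfl))
  rw [fsum_eq_ite (by fun_prop) x (fun y hy => by simp [basis_apply, hy])]
  simp [basis_apply, hxF, absSq_eq_zero.2 rfl, hε]

theorem eq_of_hasInner_basis {g : L2 R X} {y : El X} {c : Cplx R}
    (h : (basis R y).HasInner g c) : star (g y) = c := by
  classical
  rw [hasInner_iff] at h
  have hg := g.dFun
  have hy := (basis R y).dFun
  refine sub_eq_zero.1 (absSq_eq_zero.1 (le_antisymm (le_of_forall_pos_lt_add fun ε hε => ?_)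
    (absSq_nonneg _)))
  obtain ⟨F₀, hF₀⟩ := h ε hε
  have h1 := hF₀ (FinSub.insert y F₀) fun x hx => mem_adjoin.2 (Or.inl hx)
  rw [fsum_eq_ite (by fun_prop) y (fun z hz => by simp [basis_apply, hz])] at h1
  simpa [basis_apply, FinSub.mem_insert] using h1

end L2

namespace BddOp

/-- Pairing with a basis vector evaluates a coordinate, so the matrix of the adjoint is the
conjugate transpose. -/
theorem apply_basis_of_isAdjoint {T S : BddOp R X} (h : T.IsAdjoint S) (x y : El X) :
    S (L2.basis R x) y = star (T (L2.basis R y) x) := by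
  rw [← L2.eq_of_hasInner_basis ((h _ _ _).1 (L2.hasInner_basis (T (L2.basis R y)) x)), star_star]

theorem apply_eq_fsum (T : BddOp R X) (A : FinSub X) :
    ∀ f : L2 R X, (∀ x : El X, ¬ x.1 ∈ₛ A.1 → f x = 0) →
      ∀ x, T f x = fsum (fun z => f z * T (L2.basis R z) x) A := by
  classical
  have hT := T.internal.dFun
  have hb := L2.dFun_basis (R := R) (X := X)
  have hsum : ∀ (f : L2 R X) (x : El X), DFun M (fun z => f z * T (L2.basis R z) x) := by
    intro f x
    have hf := f.dFun
    fun_prop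
  refine FinSub.induction (P := fun A => ∀ f : L2 R X, (∀ x : El X, ¬ x.1 ∈ₛ A.1 → f x = 0) →
    ∀ x, T f x = fsum (fun z => f z * T (L2.basis R z) x) A) (by fun_prop) ?_ ?_ A
  · intro f hf x
    -- Here `f = 0`, so `f = -f + f` and linearity gives `T f = -T f + T f = 0`.
    have h1 := T.linear (-1) f f f (fun x => by rw [hf x (FinSub.not_mem_empty x)]; simp) x
    rw [fsum_empty (hsum f x), h1]
    simp
  · intro A z hz ih f hf x
    have hfd := f.dFun
    -- Deleting the coordinate `z` splits `f` as `f z` times the basis vector at `z` plus a vector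
    -- `g` supported in `A`.
    obtain ⟨g, hg⟩ := L2.exists_of_support (f := fun y => if y = z then 0 else f y)
      (by fun_prop) A fun y hy => by
        split_ifs with h
        · rfl
        · exact hf y fun h' => (FinSub.mem_insert.1 h').elim hy h
    have hgd := g.dFun
    rw [T.linear (f z) (L2.basis R z) g f (fun y => ?_) x, fsum_insert (hsum f x) hz, ih g ?_ x,
      add_comm]
    · refine congrArg (· + _) (fsum_congr (hsum g x) (hsum f x) A fun y hy => ?_)
      rw [hg, if_neg]
      rintro rfl
      exact hz hy
    · intro y hy
      rw [hg]
      split_ifs with h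
      · rfl
      · exact hf y fun h' => (FinSub.mem_insert.1 h').elim hy h
    · rw [hg, L2.basis_apply]
      split_ifs with h
      · rw [h]; simp
      · simp

end BddOp

theorem dFun_entryApply {n : Omega M} (V : OpMatrix R X n) :
    DFun M (fun p : (El n.1 × El n.1) × L2 R X => (V.entry p.1).toFun p.2) := by
  obtain ⟨G, hG⟩ := V.internal
  refine DFun.of_graph ?_
  -- The operator in position `(i, j)` is reached through its graph, a set `T` of the model, so no
  -- quantifier over operators is needed.
  have : DFun M (fun q : ((El n.1 × El n.1) × L2 R X) × L2 R X => ∃ T : M,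
    pair (Coded.code q.1.1) T ∈ₛ G ∧ pair (Coded.code q.1.2) (Coded.code q.2) ∈ₛ T) := by fun_prop
  convert this using 2 with q
  constructor
  · rintro h
    exact ⟨_, (hG _).2 ⟨q.1.1, rfl⟩, (pair_mem_graph (V.entry q.1.1).internal _ _).2 h⟩
  · rintro ⟨T, h1, h2⟩
    obtain ⟨ij, h⟩ := (hG _).1 h1
    obtain ⟨h3, rfl⟩ := pair_inj h
    rw [code_inj] at h3
    subst h3
    exact (pair_mem_graph (V.entry q.1.1).internal _ _).1 h2

@[fun_prop]
theorem DFun.entryApply {n : Omega M} (V : OpMatrix R X n) {i j : γ → El n.1} {f : γ → L2 R X}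
    (hi : DFun M i) (hj : DFun M j) (hf : DFun M f) :
    DFun M (fun p => (V.entry (i p, j p)).toFun (f p)) := by
  have h := (dFun_entryApply V).comp ((hi.prodMk hj).prodMk hf)
  exact h

end SquareSummable

end ZFModel

namespace ZFModel

open Function

/-! ### Sums over a product of two finite sets -/

section DoubleSums

variable {M : Type u} [setLang.Structure M] [ZFModel M] {X Y : M}
variable {β : Type*} {γ : Type*} [Coded M β] [Coded M γ] [DType M γ]
variable [AddCommMonoid β] [DType M β] [DAdd M β]

/-- The sum of the values of `g` over the finite set `U × A`. -/
noncomputable def fsum₂ (U : FinSub Y) (A : FinSub X) (g : El Y × El X → β) : β :=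
  fsum (fun k => fsum (fun z => g (k, z)) A) U

variable (U : FinSub Y) (A : FinSub X)

@[fun_prop]
theorem DFun.fsum₂ {g : γ → El Y × El X → β} (hg : DFun M (fun p : γ × (El Y × El X) => g p.1 p.2)) :
    DFun M (fun p => ZFModel.fsum₂ U A (g p)) := by
  unfold ZFModel.fsum₂
  fun_prop

theorem fsum₂_congr {g h : El Y × El X → β} (hg : DFun M g) (hh : DFun M h)
    (hgh : ∀ a : El Y × El X, a.2.1 ∈ₛ A.1 → g a = h a) : fsum₂ U A g = fsum₂ U A h :=
  fsum_congr (by fun_prop) (by fun_prop) U fun k _ =>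
    fsum_congr (by fun_prop) (by fun_prop) A fun z hz => hgh (k, z) hz

theorem map_fsum₂ {β' : Type*} [Coded M β'] [AddCommMonoid β'] [DType M β'] [DAdd M β']
    (φ : β →+ β') (hφ : DFun M φ) {g : El Y × El X → β} (hg : DFun M g) :
    φ (fsum₂ U A g) = fsum₂ U A (fun a => φ (g a)) := by
  unfold fsum₂
  rw [map_fsum φ hφ (by fun_prop)]
  refine fsum_congr (by fun_prop) (by fun_prop) U fun k _ => ?_
  rw [map_fsum φ hφ (by fun_prop)]

theorem fsum₂_add {g h : El Y × El X → β} (hg : DFun M g) (hh : DFun M h) :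
    fsum₂ U A (fun a => g a + h a) = fsum₂ U A g + fsum₂ U A h := by
  unfold fsum₂
  rw [← fsum_add (by fun_prop) (by fun_prop)]
  refine fsum_congr (by fun_prop) (by fun_prop) U fun k _ => ?_
  rw [fsum_add (by fun_prop) (by fun_prop)]

theorem fsum₂_comm {g : El Y × El X → El Y × El X → β}
    (hg : DFun M (fun p : (El Y × El X) × (El Y × El X) => g p.1 p.2)) :
    fsum₂ U A (fun a => fsum₂ U A (g a)) = fsum₂ U A (fun b => fsum₂ U A (fun a => g a b)) := by
  unfold fsum₂
  calc fsum (fun k => fsum (fun z => fsum (fun l => fsum (fun y => g (k, z) (l, y)) A) U) A) U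
      = fsum (fun k => fsum (fun l => fsum (fun z => fsum (fun y => g (k, z) (l, y)) A) A) U) U :=
        fsum_congr (by fun_prop) (by fun_prop) U fun k _ => fsum_comm (by fun_prop) A U
    _ = fsum (fun l => fsum (fun k => fsum (fun z => fsum (fun y => g (k, z) (l, y)) A) A) U) U :=
        fsum_comm (by fun_prop) U U
    _ = fsum (fun l => fsum (fun k => fsum (fun y => fsum (fun z => g (k, z) (l, y)) A) A) U) U :=
        fsum_congr (by fun_prop) (by fun_prop) U fun l _ =>
          fsum_congr (by fun_prop) (by fun_prop) U fun k _ => fsum_comm (by fun_prop) A A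
    _ = fsum (fun l => fsum (fun y => fsum (fun k => fsum (fun z => g (k, z) (l, y)) A) U) A) U :=
        fsum_congr (by fun_prop) (by fun_prop) U fun l _ => fsum_comm (by fun_prop) U A

theorem fsum₂_eq_single {g : El Y × El X → β} (hg : DFun M g) (a : El Y × El X)
    (h1 : a.1.1 ∈ₛ U.1) (h2 : a.2.1 ∈ₛ A.1) (h : ∀ b, b ≠ a → g b = 0) : fsum₂ U A g = g a := by
  classical
  unfold fsum₂
  rw [fsum_eq_ite (by fun_prop) a.1, if_pos h1, fsum_eq_ite (by fun_prop) a.2, if_pos h2]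
  · intro x hx
    exact h _ fun h' => hx (congrArg Prod.snd h')
  · intro k hk
    rw [← fsum_zero A]
    exact fsum_congr (by fun_prop) (by fun_prop) A fun z _ =>
      h _ fun h' => hk (congrArg Prod.fst h')

end DoubleSums

/-! ### Finite isometric matrices are unitary -/

section Matrices

variable {M : Type u} [setLang.Structure M] [ZFModel M] {R : Reals M} {X Y : M}
variable (U : FinSub Y) (A : FinSub X)

theorem eq_zero_of_fsum₂_eq_zero {g : El Y × El X → El R.carrier} (hg : DFun M g)
    (h : ∀ a, 0 ≤ g a) (h0 : fsum₂ U A g = 0) {a : El Y × El X} (h1 : a.1.1 ∈ₛ U.1)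
    (h2 : a.2.1 ∈ₛ A.1) : g a = 0 := by
  have h3 := eq_zero_of_fsum_eq_zero (by fun_prop) (fun k => fsum_nonneg (by fun_prop)
    (fun z => h (k, z)) A) h0 h1
  exact eq_zero_of_fsum_eq_zero (g := fun z => g (a.1, z)) (by fun_prop) (fun z => h _) h3 h2

theorem mul_fsum {g : El X → Cplx R} (hg : DFun M g) (c : Cplx R) :
    c * fsum g A = fsum (fun a => c * g a) A :=
  map_fsum (AddMonoidHom.mulLeft c) (by simp only [AddMonoidHom.coe_mulLeft]; fun_prop) hg A

theorem mul_fsum₂ {g : El Y × El X → Cplx R} (hg : DFun M g) (c : Cplx R) :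
    c * fsum₂ U A g = fsum₂ U A (fun a => c * g a) :=
  map_fsum₂ U A (AddMonoidHom.mulLeft c) (by simp only [AddMonoidHom.coe_mulLeft]; fun_prop) hg

/-- The product of the matrices `x` and `y` with index set `U × A`. -/
noncomputable def matMul (x y : El Y × El X → El Y × El X → Cplx R) (a c : El Y × El X) : Cplx R :=
  fsum₂ U A (fun b => x a b * y b c)

variable {x y z : El Y × El X → El Y × El X → Cplx R}

theorem dFun_matMul (hx : DFun M (fun p : (El Y × El X) × (El Y × El X) => x p.1 p.2))
    (hy : DFun M (fun p : (El Y × El X) × (El Y × El X) => y p.1 p.2)) :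
    DFun M (fun p : (El Y × El X) × (El Y × El X) => matMul U A x y p.1 p.2) := by
  unfold matMul
  fun_prop

theorem matMul_assoc (hx : DFun M (fun p : (El Y × El X) × (El Y × El X) => x p.1 p.2))
    (hy : DFun M (fun p : (El Y × El X) × (El Y × El X) => y p.1 p.2))
    (hz : DFun M (fun p : (El Y × El X) × (El Y × El X) => z p.1 p.2)) (a d : El Y × El X) :
    matMul U A (matMul U A x y) z a d = matMul U A x (matMul U A y z) a d := by
  unfold matMul
  calc fsum₂ U A (fun c => fsum₂ U A (fun b => x a b * y b c) * z c d)
      = fsum₂ U A (fun c => fsum₂ U A (fun b => x a b * (y b c * z c d))) := by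
        refine fsum₂_congr U A (by fun_prop) (by fun_prop) fun c _ => ?_
        rw [mul_comm, mul_fsum₂ U A (by fun_prop)]
        exact fsum₂_congr U A (by fun_prop) (by fun_prop) fun b _ => by ring
    _ = fsum₂ U A (fun b => fsum₂ U A (fun c => x a b * (y b c * z c d))) :=
        fsum₂_comm U A (by fun_prop)
    _ = fsum₂ U A (fun b => x a b * fsum₂ U A (fun c => y b c * z c d)) := by
        refine fsum₂_congr U A (by fun_prop) (by fun_prop) fun b _ => ?_
        rw [mul_fsum₂ U A (by fun_prop)]

variable (R) in
/-- The real part as an additive map. -/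
def reHom : Cplx R →+ El R.carrier where
  toFun z := z.re
  map_zero' := rfl
  map_add' _ _ := rfl

open Classical in
/-- A finite square matrix `v` with `v* v = 1` satisfies `v v* = 1`. -/
theorem matMul_star_eq_one {v w : El Y × El X → El Y × El X → Cplx R} (hU : ∀ k : El Y, k.1 ∈ₛ U.1)
    (hv : DFun M (fun p : (El Y × El X) × (El Y × El X) => v p.1 p.2))
    (hw : DFun M (fun p : (El Y × El X) × (El Y × El X) => w p.1 p.2))
    (hstar : ∀ a b, w a b = star (v b a))
    (hwv : ∀ a c : El Y × El X, a.2.1 ∈ₛ A.1 → c.2.1 ∈ₛ A.1 →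
      matMul U A w v a c = if a = c then 1 else 0)
    (a c : El Y × El X) (ha : a.2.1 ∈ₛ A.1) (hc : c.2.1 ∈ₛ A.1) :
    matMul U A v w a c = if a = c then 1 else 0 := by
  have hp := dFun_matMul U A hv hw
  have hq := dFun_matMul U A hw hv
  have hwp := dFun_matMul U A hw hp
  -- The matrix `p = v v*` is a self-adjoint idempotent. It will be shown that `q = p - 1` vanishes,
  -- by computing the sum of all `|q a c|²` with traces.
  obtain ⟨p, hpdef⟩ : ∃ p, p = matMul U A v w := ⟨_, rfl⟩
  rw [← hpdef] at hp hwp ⊢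
  have hpstar : ∀ a b, star (p a b) = p b a := by
    intro a b
    simp only [hpdef, matMul]
    have h := map_fsum₂ U A (starAddEquiv : Cplx R ≃+ Cplx R).toAddMonoidHom
      (show DFun M (fun z : Cplx R => star z) by fun_prop)
      (g := fun c => v a c * w c b) (by fun_prop)
    refine h.trans (fsum₂_congr U A ?_ (by fun_prop) fun c _ => ?_)
    · change DFun M (fun c => star (v a c * w c b))
      fun_prop
    · change star (v a c * w c b) = _
      rw [star_mul, hstar c b, star_star, hstar c a]
  -- By associativity `w (v w) = (w v) w = w`; this yields `p p = p`.
  have hwp_eq : ∀ b d : El Y × El X, b.2.1 ∈ₛ A.1 → matMul U A w p b d = w b d := by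
    intro b d hb
    rw [hpdef, ← matMul_assoc U A hw hv hw]
    change fsum₂ U A (fun c => matMul U A w v b c * w c d) = _
    have h : DFun M (fun c => if b = c then w c d else 0) := by fun_prop
    rw [fsum₂_congr U A (h := fun c => if b = c then w c d else 0) (by fun_prop) h,
      fsum₂_eq_single U A h b (hU _) hb, if_pos rfl]
    · exact fun c hc => if_neg hc.symm
    · intro c hc
      rw [hwv b c hb hc]
      split_ifs <;> simp
  have hpp : ∀ a, matMul U A p p a a = p a a := by
    intro a
    conv_lhs => rw [show matMul U A p p = matMul U A (matMul U A v w) p by rw [← hpdef]]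
    rw [matMul_assoc U A hv hw hp]
    conv_rhs => rw [hpdef]
    exact fsum₂_congr U A (by fun_prop) (by fun_prop) fun b hb => by rw [hwp_eq b a hb]
  obtain ⟨q, hqdef⟩ : ∃ q : El Y × El X → El Y × El X → Cplx R,
    ∀ a c, q a c = p a c - if a = c then 1 else 0 := ⟨_, fun _ _ => rfl⟩
  have hqd : DFun M (fun r : (El Y × El X) × (El Y × El X) => q r.1 r.2) := by
    simp only [hqdef]
    fun_prop
  -- Since `p` is self-adjoint and idempotent, the diagonal entry of `q q*` at `a` is `p a a - 2 p a
  -- a + 1 = 1 - p a a`.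
  have hrow : ∀ a : El Y × El X, a.2.1 ∈ₛ A.1 →
      fsum₂ U A (fun c => q a c * star (q a c)) + p a a = 1 := by
    intro a ha
    have hs : DFun M (fun c => if c = a then 1 - 2 * p a a else 0) := by fun_prop
    have h1 : fsum₂ U A (fun c => q a c * star (q a c)) =
        fsum₂ U A (fun c => p a c * p c a + if c = a then 1 - 2 * p a a else 0) := by
      refine fsum₂_congr U A (by fun_prop) (by fun_prop) fun c _ => ?_
      rw [hqdef]
      by_cases h : c = a
      · subst h
        simp only [if_true, star_sub, star_one, hpstar]
        ring
      · simp [h, Ne.symm h, hpstar]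
    rw [h1, fsum₂_add U A (by fun_prop) hs,
      fsum₂_eq_single U A hs a (hU _) ha (fun c hc => if_neg hc), if_pos rfl,
      show fsum₂ U A (fun c => p a c * p c a) = p a a from hpp a]
    ring
  -- Cyclicity of the trace: `v w` and `w v = 1` have the same trace.
  have htrace : fsum₂ U A (fun a => p a a) = fsum₂ U A (fun _ => 1) := by
    rw [hpdef]
    unfold matMul
    rw [fsum₂_comm U A (g := fun a b => v a b * w b a) (by fun_prop)]
    refine fsum₂_congr U A (by fun_prop) (by fun_prop) fun b hb => ?_
    refine Eq.trans ?_ ((hwv b b hb hb).trans (if_pos rfl))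
    exact fsum₂_congr U A (by fun_prop) (by fun_prop) fun a _ => mul_comm _ _
  have htotal : fsum₂ U A (fun a => fsum₂ U A (fun c => q a c * star (q a c))) = 0 := by
    have h := fsum₂_add U A (g := fun a => fsum₂ U A (fun c => q a c * star (q a c)))
      (h := fun a => p a a) (by fun_prop) (by fun_prop)
    rw [fsum₂_congr U A (h := fun _ => 1) (by fun_prop) (by fun_prop) hrow, htrace] at h
    exact left_eq_add.1 ((add_comm _ _).trans h.symm).symm
  -- Taking real parts gives a vanishing sum of nonnegative reals, so every term is zero.
  have hre : fsum₂ U A (fun a => fsum₂ U A (fun c => absSq (q a c))) = 0 := by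
    have hr : DFun M (reHom R) := show DFun M (fun z : Cplx R => z.re) by fun_prop
    have h := congrArg (reHom R) htotal
    rw [map_fsum₂ U A _ hr (by fun_prop), map_zero] at h
    rw [← h]
    refine fsum₂_congr U A (by fun_prop) (by fun_prop) fun a _ => ?_
    rw [map_fsum₂ U A _ hr (by fun_prop)]
    exact fsum₂_congr U A (by fun_prop) (by fun_prop) fun c _ => (re_mul_star _).symm
  have hnn : ∀ a, 0 ≤ fsum₂ U A (fun c => absSq (q a c)) := fun a =>
    fsum_nonneg (by fun_prop) (fun k => fsum_nonneg (by fun_prop) (fun z => absSq_nonneg _) A) U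
  have h1 := eq_zero_of_fsum₂_eq_zero U A (by fun_prop) hnn hre (hU a.1) ha
  have h2 := eq_zero_of_fsum₂_eq_zero U A (by fun_prop) (fun c => absSq_nonneg (q a c)) h1 (hU c.1) hc
  rw [absSq_eq_zero, hqdef, sub_eq_zero] at h2
  exact h2

end Matrices

/-! ### Finite invariant subspaces and stable finiteness -/

section StableFiniteness

variable {M : Type u} [setLang.Structure M] [ZFModel M] {R : Reals M} {X Y : M}

theorem FinSub.exists_iUnion {Q : El Y → El X → Prop} (hQ : DFun M (fun p : El Y × El X => Q p.1 p.2))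
    (F : FinSub Y) (h : ∀ y, ∃ B : FinSub X, ∀ x : El X, x.1 ∈ₛ B.1 ↔ Q y x) :
    ∃ C : FinSub X, ∀ x : El X, x.1 ∈ₛ C.1 ↔ ∃ y : El Y, y.1 ∈ₛ F.1 ∧ Q y x := by
  choose B hB using h
  have hBd : DFun M B := dFun_of_mem (by simp only [hB]; fun_prop)
  obtain ⟨C, hC⟩ := exists_biUnion hBd F
  exact ⟨C, fun x => by simp only [hC, hB]⟩

/-- The exact support, unlike a mere finite set containing it, is unique; hence it depends definably
on the vector, with no appeal to choice. -/
theorem L2.exists_support_eq (hX : CohenFinite X) (f : L2 R X) :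
    ∃ S : FinSub X, ∀ x : El X, x.1 ∈ₛ S.1 ↔ ¬ f x = 0 := by
  obtain ⟨S, hS⟩ := f.exists_support hX
  have hf := f.dFun
  exact FinSub.exists_of_bounded (by fun_prop) S fun x hx => by_contra fun h => hx (hS x h)

variable {n : Omega M}

variable (n) in
/-- The natural number `n` as a finite subset of itself. -/
noncomputable def Omega.univ : FinSub n.1 :=
  ⟨n.1, fun _ h => h, n, fun x => x, dFun_id.internal, Function.bijective_id⟩

theorem OpMatrix.exists_invariant (hX : CohenFinite X) (V W : OpMatrix R X n) (A₀ : FinSub X) :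
    ∃ A : FinSub X, (∀ x : El X, x.1 ∈ₛ A₀.1 → x.1 ∈ₛ A.1) ∧ ∀ (i j : El n.1) (y : El X),
      y.1 ∈ₛ A.1 → ∀ x : El X, ¬ x.1 ∈ₛ A.1 →
        V.entry (i, j) (L2.basis R y) x = 0 ∧ W.entry (i, j) (L2.basis R y) x = 0 := by
  have hb := L2.dFun_basis (R := R) (X := X)
  have hd : ∀ V : OpMatrix R X n, DFun M (fun p : El X × El n.1 × El n.1 × El X =>
      (V.entry (p.2.1, p.2.2.1)).toFun (L2.basis R p.1) p.2.2.2) := fun V => by fun_prop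
  have h1 : ∀ (V : OpMatrix R X n) (A : FinSub X), ∃ B : FinSub X, ∀ x : El X, x.1 ∈ₛ B.1 ↔
      ∃ y : El X, y.1 ∈ₛ A.1 ∧ ∃ i : El n.1, i.1 ∈ₛ (Omega.univ n).1 ∧
        ∃ j : El n.1, j.1 ∈ₛ (Omega.univ n).1 ∧ ¬ V.entry (i, j) (L2.basis R y) x = 0 :=
    fun V A => FinSub.exists_iUnion (by fun_prop) A fun y =>
      FinSub.exists_iUnion (by fun_prop) (Omega.univ n) fun i =>
        FinSub.exists_iUnion (by fun_prop) (Omega.univ n) fun j => L2.exists_support_eq hX _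
  -- The increasing map adjoins the supports of all columns indexed by `A` of all entries of `V` and
  -- `W`; its fixed points are the invariant sets.
  have h2 : ∀ A : FinSub X, ∃ B : FinSub X, ∀ x : El X, x.1 ∈ₛ B.1 ↔ x.1 ∈ₛ A.1 ∨
      ((∃ y : El X, y.1 ∈ₛ A.1 ∧ ∃ i : El n.1, i.1 ∈ₛ (Omega.univ n).1 ∧
        ∃ j : El n.1, j.1 ∈ₛ (Omega.univ n).1 ∧ ¬ V.entry (i, j) (L2.basis R y) x = 0) ∨
      (∃ y : El X, y.1 ∈ₛ A.1 ∧ ∃ i : El n.1, i.1 ∈ₛ (Omega.univ n).1 ∧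
        ∃ j : El n.1, j.1 ∈ₛ (Omega.univ n).1 ∧ ¬ W.entry (i, j) (L2.basis R y) x = 0)) := by
    intro A
    obtain ⟨B, hB⟩ := h1 V A
    obtain ⟨C, hC⟩ := h1 W A
    obtain ⟨D, hD⟩ := FinSub.exists_union B C
    obtain ⟨E, hE⟩ := FinSub.exists_union A D
    exact ⟨E, fun x => by rw [hE, hD, hB, hC]⟩
  choose ψ hψ using h2
  have hψd : DFun M ψ := FinSub.dFun_of_mem (by simp only [hψ]; fun_prop)
  obtain ⟨A, hA₀, hA⟩ := hX.exists_fixed hψd (fun A x hx => (hψ A x).2 (Or.inl hx)) A₀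
  refine ⟨A, hA₀, fun i j y hy x hx => ?_⟩
  rw [← hA, hψ] at hx
  push Not at hx
  exact ⟨hx.2.1 y hy i i.2 j j.2, hx.2.2 y hy i i.2 j j.2⟩

theorem CohenFinite.stablyFinite (hX : CohenFinite X) : StablyFinite R X := by
  classical
  rintro n ⟨V, W, hVW, hWV, hne⟩
  refine hne fun i j f x₀ => ?_
  have hb := L2.dFun_basis (R := R) (X := X)
  have hf := f.dFun
  obtain ⟨S, hS⟩ := f.exists_support hX
  -- The equation to prove concerns one vector `f` and one coordinate `x₀`, so an invariant finite
  -- set containing the support of `f` and `x₀` suffices.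
  obtain ⟨A, hSA, hA⟩ := V.exists_invariant hX W (FinSub.insert x₀ S)
  have hx₀ : x₀.1 ∈ₛ A.1 := hSA x₀ (FinSub.mem_insert.2 (Or.inr rfl))
  have hfA : ∀ x : El X, ¬ x.1 ∈ₛ A.1 → f x = 0 := fun x hx =>
    hS x fun h => hx (hSA x (FinSub.mem_insert.2 (Or.inl h)))
  -- The operators restrict to a scalar matrix indexed by `n × A`. Its isometry relation is `W V =
  -- 1` tested on basis vectors, where invariance of `A` reduces each composition to a sum over `A`.
  have key := matMul_star_eq_one (Omega.univ n) A
    (v := fun a b => V.entry (a.1, b.1) (L2.basis R b.2) a.2)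
    (w := fun a b => W.entry (a.1, b.1) (L2.basis R b.2) a.2)
    (fun k => k.2) (by fun_prop) (by fun_prop)
    (fun a b => BddOp.apply_basis_of_isAdjoint (hVW a.1 b.1) b.2 a.2) (by
      intro a c ha hc
      have h := (hasFinSum_iff (X := n.1)
        (g := fun k => W.entry (a.1, k) (V.entry (k, c.1) (L2.basis R c.2)) a.2)
        (by fun_prop) (Omega.univ n) _).1 (hWV a.1 c.1 (L2.basis R c.2) a.2)
      rw [L2.basis_apply] at h
      refine Eq.trans ?_ (h.symm.trans ?_)
      · refine fsum_congr (by fun_prop) (by fun_prop) _ fun k _ => ?_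
        rw [(W.entry (a.1, k)).apply_eq_fsum A _ fun x hx => (hA k c.1 c.2 hc x hx).1]
        exact fsum_congr (by fun_prop) (by fun_prop) A fun z _ => mul_comm _ _
      · rw [← ite_and]
        exact if_congr Prod.ext_iff.symm rfl rfl)
  refine (hasFinSum_iff (X := n.1) (g := fun k => V.entry (i, k) (W.entry (k, j) f) x₀)
    (by fun_prop) (Omega.univ n) _).2 ?_
  have hW : ∀ (k : El n.1) (z : El X), W.entry (k, j) f z =
      fsum (fun y => f y * W.entry (k, j) (L2.basis R y) z) A :=
    fun k z => (W.entry (k, j)).apply_eq_fsum A f hfA z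
  -- Expanding both operators in the basis is legitimate because the image of `f` under the entry of
  -- `W` is again supported in `A`.
  have hterm : ∀ k : El n.1, V.entry (i, k) (W.entry (k, j) f) x₀ =
      fsum (fun y => f y * fsum (fun z => V.entry (i, k) (L2.basis R z) x₀ *
        W.entry (k, j) (L2.basis R y) z) A) A := by
    intro k
    have hWk : DFun M (fun z => W.entry (k, j) f z) := by fun_prop
    rw [(V.entry (i, k)).apply_eq_fsum A _ fun z hz => by
      rw [hW, fsum_congr (h := fun _ => 0) (by fun_prop) (by fun_prop) A
        (fun y hy => by rw [(hA k j y hy z hz).2, mul_zero]), fsum_zero]]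
    calc fsum (fun z => W.entry (k, j) f z * V.entry (i, k) (L2.basis R z) x₀) A
        = fsum (fun z => fsum (fun y => f y * (V.entry (i, k) (L2.basis R z) x₀ *
          W.entry (k, j) (L2.basis R y) z)) A) A := by
          refine fsum_congr (by fun_prop) (by fun_prop) A fun z _ => ?_
          rw [hW, mul_comm, mul_fsum A (by fun_prop)]
          exact fsum_congr (by fun_prop) (by fun_prop) A fun y _ => by ring
      _ = fsum (fun y => fsum (fun z => f y * (V.entry (i, k) (L2.basis R z) x₀ *
          W.entry (k, j) (L2.basis R y) z)) A) A := fsum_comm (by fun_prop) A A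
      _ = _ := fsum_congr (by fun_prop) (by fun_prop) A fun y _ =>
          (mul_fsum A (by fun_prop) _).symm
  have hδ : DFun M (fun y => f y * if (i, x₀) = (j, y) then 1 else 0) := by fun_prop
  -- After exchanging the sums over `k` and `y`, the inner double sum is an entry of the matrix
  -- product `v v*`, known from `key`.
  have hsum : fsum (fun k => V.entry (i, k) (W.entry (k, j) f) x₀) (Omega.univ n) =
      fsum (fun y => f y * if (i, x₀) = (j, y) then 1 else 0) A := by
    calc fsum (fun k => V.entry (i, k) (W.entry (k, j) f) x₀) (Omega.univ n)
        = fsum (fun k => fsum (fun y => f y * fsum (fun z => V.entry (i, k) (L2.basis R z) x₀ *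
          W.entry (k, j) (L2.basis R y) z) A) A) (Omega.univ n) :=
          fsum_congr (by fun_prop) (by fun_prop) _ fun k _ => hterm k
      _ = fsum (fun y => fsum (fun k => f y * fsum (fun z => V.entry (i, k) (L2.basis R z) x₀ *
          W.entry (k, j) (L2.basis R y) z) A) (Omega.univ n)) A := fsum_comm (by fun_prop) _ A
      _ = _ := by
          refine fsum_congr (by fun_prop) hδ A fun y hy => ?_
          rw [← mul_fsum _ (by fun_prop), ← key (i, x₀) (j, y) hx₀ hy]
          rfl
  rw [hsum, fsum_eq_ite hδ x₀, if_pos hx₀]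
  · by_cases h : i = j <;> simp [h]
  · intro y hy
    rw [if_neg, mul_zero]
    exact fun h => hy (congrArg Prod.snd h).symm

end StableFiniteness

end ZFModel

theorem corollaryC {M : Type*} [setLang.Structure M] [ZFModel M]
    (R : ZFModel.Reals M) (X : M) (hX : ZFModel.CF X) :
    ZFModel.StablyFinite R X :=
  hX.2.stablyFinite
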